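/- Let $\mathbb F_q$ be a finite field, $A=\mathbb F_q[T]$, $K=\mathbb F_q(T)$, let $K_\infty$ be the completion of $K$ at $\infty=1/T$ with $|T|=q$, $\mathbb C_\infty$ the completion of an algebraic closure of $K_\infty$, and $\Omega=\mathbb C_\infty\setminus K_\infty$. For $\gamma=\begin{pmatrix}a&b\\c&d\end{pmatrix}\in \mathrm{GL}_2(K_\infty)$ and $k,m\in\mathbb Z$ put $(f|_{k,m}\gamma)(z)=(\det\gamma)^m(cz+d)^{-k}f(\gamma z)$. Let $\mathcal O$ be the ring of rigid analytic functions $\Omega\to\mathbb C_\infty$ that are $I$-periodic for some nonzero ideal $I$ of $A$. Let $\tilde\pi$ be a period of the Carlitz module $T\mapsto T+\tau$ (a generator of the lattice $\ker e_C=\tilde\pi A$), and let $$E(z)=\tilde\pi^{-1}\sum_{a\in A\text{ monic}}\ \sum_{b\in A}\frac{a}{az+b}.$$ Let $\Gamma\subseteq\mathrm{GL}_2(A)$ be an arithmetic subgroup of congruence type, i.e. a subgroup of $\mathrm{GL}_2(A)$ containing $\Gamma(\mathfrak m)=\{\gamma\in\mathrm{GL}_2(A):\gamma\equiv 1 \bmod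 \mathfrak m\}$ for some nonzero ideal $\mathfrak m$ of $A$. For $k,m\in\mathbb Z$ and $\ell\ge 0$: * $\widetilde W^{\le\ell}_{k,m}(\Gamma)$ is the $\mathbb C_\infty$-space of rigid analytic $f:\Omega\to\mathbb C_\infty$ for which there is a polynomial $P_f=\sum_{i=0}^{\ell}f_iX^i\in\mathcal O[X]$ (the associated polynomial of $f$) with $(f|_{k,m}\gamma)(z)=\sum_i f_i(z)\left(\frac{c}{cz+d}\right)^i$ for all $\gamma\in\Gamma$, $z\in\Omega$; $\widetilde W_{k,m}(\Gamma)=\bigcup_\ell\widetilde W^{\le\ell}_{k,m}(\Gamma)$ and $W_{k,m}(\Gamma)=\widetilde W^{\le0}_{k,m}(\Gamma)$. * $\mathcal{WP}^{\le\ell}_{k,m}(\Gamma)$ is the space of $P(z,X)\in\mathcal O[X]$ of degree at most $\ell$ with $(\det\gamma)^m(cz+d)^{-k}P\!\left(\gamma z,\frac{(cz+d)^2}{\det\gamma}\left(X-\frac{c}{cz+d}\right)\right)=P(z,X)$ for all $\gamma\in\Gamma$, $z\in\Omega$; $\mathcal{WP}_{k,m}(\Gamma)=\bigcup_\ell\mathcal{WP}^{\le\ell}_{k,m}(\Gamma)$.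 Then the following hold. 1. For all $k,m\in\mathbb Z$, substituting the function $E$ gives an isomorphism $\bigoplus_{i\ge0}W_{k-2i,m-i}(\Gamma)E^i\cong\widetilde W_{k,m}(\Gamma)$, which for every $\ell$ identifies $\bigoplus_{i=0}^{\ell}W_{k-2i,m-i}(\Gamma)E^i$ with $\widetilde W^{\le\ell}_{k,m}(\Gamma)$. So every $f\in\widetilde W_{k,m}(\Gamma)$ has a unique $E$-expansion $\mathcal E_f=(f_{i,E})_i$ with $f_{i,E}\in W_{k-2i,m-i}(\Gamma)$ and $f=\sum_i f_{i,E}E^i$. Also, $P_f$ is unique. The maps $$\psi:\bigoplus_{i\ge0}W_{k-2i,m-i}(\Gamma)E^i\to\mathcal{WP}_{k,m}(\Gamma),\ \mathcal E_f\mapsto P_f,\qquad \varphi:\mathcal{WP}_{k,m}(\Gamma)\to\bigoplus_{i\ge0}W_{k-2i,m-i}(\Gamma)E^i,\ P_f\mapsto\mathcal E_f,$$ are well defined, mutually inverse isomorphisms of $\mathbb C_\infty$-vector spaces filtered by depth. 2. $E\in\widetilde W_{2,1}(\Gamma)$, with $P_E=E-\tilde\pi^{-1}X\in\mathcal{WP}_{2,1}(\Gamma)$,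 and $\psi,\varphi$ induce mutually inverse isomorphisms of filtered, bigraded (by weight and type) $\mathbb C_\infty[E]$-algebras $$\Psi:\ \widetilde W(\Gamma)=\bigoplus_{k,m\in\mathbb Z}\ \bigoplus_{i\ge0}W_{k-2i,m-i}(\Gamma)E^i\ \rightleftarrows\ \mathcal{WP}(\Gamma)=\bigoplus_{k,m\in\mathbb Z}\mathcal{WP}_{k,m}(\Gamma)\ :\Phi,$$ where the direct sums over $(k,m)$ are external, $\mathbb C_\infty[E]$ is the polynomial ring, and $E$ acts by $E\cdot\mathcal E_f=\mathcal E_{Ef}=(0,\mathcal E_f)$ on the left and by $E\cdot P_f=P_{Ef}=P_EP_f$ on the right. The identification in 1 likewise induces an isomorphism of filtered bigraded $\mathbb C_\infty[E]$-algebras of the left side with $\bigoplus_{k,m}\widetilde W_{k,m}(\Gamma)$. -/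

import Mathlib

open Polynomial DirectSum
open scoped WithZero NNReal

noncomputable section

namespace DrinfeldQM

/-! ### The fields `K = 𝔽_q(T)`, `K_∞`, `ℂ_∞` -/

section Fields

variable (Fq : Type*) [Field Fq]

open scoped Classical in
/-- `K_∞`: the completion of `𝔽_q(T)` at the place `∞ = 1/T`. -/
abbrev Kinf := RatFunc.CompletionAtInfty Fq

variable [Finite Fq]

open scoped Classical in
/-- The absolute value on `K_∞` is normalised by `|T| = q`. -/
instance instRankOneKinf : Valuation.RankOne (Valued.v : Valuation (Kinf Fq) ℤᵐ⁰) where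
  hom' := (WithZeroMulInt.toNNReal (e := (Nat.card Fq : ℝ≥0)) (by
    exact_mod_cast Nat.card_pos.ne')).comp MonoidWithZeroHom.ValueGroup₀.embedding
  strictMono' := (WithZeroMulInt.toNNReal_strictMono
    (by exact_mod_cast Finite.one_lt_card)).comp MonoidWithZeroHom.ValueGroup₀.embedding_strictMono
  exists_val_nontrivial := by
    let : Valued (RatFunc Fq) ℤᵐ⁰ := RatFunc.inftyValued Fq
    refine ⟨algebraMap (RatFunc Fq) (Kinf Fq) RatFunc.X, ?_⟩
    have h : Valued.v (algebraMap (RatFunc Fq) (Kinf Fq) RatFunc.X) = WithZero.exp (1 : ℤ) := by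
      refine (Valued.extensionValuation_apply_coe (K := RatFunc Fq) RatFunc.X).trans ?_
      exact RatFunc.inftyValuation.X Fq
    rw [h]
    constructor
    · exact WithZero.exp_ne_zero
    · intro h1
      rw [← WithZero.exp_zero] at h1
      exact one_ne_zero (WithZero.exp_injective h1)

instance instNFKinf : NontriviallyNormedField (Kinf Fq) :=
  Valued.toNontriviallyNormedField (Kinf Fq) ℤᵐ⁰

instance instUltraKinf : IsUltrametricDist (Kinf Fq) := by
  open scoped Valued in
  exact inferInstanceAs (@IsUltrametricDist (Kinf Fq)
    (Valued.toNormedField (Kinf Fq) ℤᵐ⁰).toDist)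

open scoped Classical in
instance instCompleteKinf : CompleteSpace (Kinf Fq) := by
  let : Valued (RatFunc Fq) ℤᵐ⁰ := RatFunc.inftyValued Fq
  exact inferInstanceAs (CompleteSpace (UniformSpace.Completion (RatFunc Fq)))

/-- An algebraic closure of `K_∞`, with the unique extension of the absolute value. -/
abbrev KinfAlg := AlgebraicClosure (Kinf Fq)

instance instNFKinfAlg : NormedField (KinfAlg Fq) :=
  spectralNorm.normedField (Kinf Fq) (KinfAlg Fq)

instance instNAKinfAlg : NormedAlgebra (Kinf Fq) (KinfAlg Fq) :=
  spectralNorm.normedAlgebra (Kinf Fq) (KinfAlg Fq)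

instance instUCSMul : UniformContinuousConstSMul (Kinf Fq) (KinfAlg Fq) :=
  uniformContinuousConstSMul_of_continuousConstSMul (Kinf Fq) (KinfAlg Fq)

instance instUltraKinfAlg : IsUltrametricDist (KinfAlg Fq) :=
  IsUltrametricDist.isUltrametricDist_of_forall_norm_add_le_max_norm
    (isNonarchimedean_spectralNorm (K := Kinf Fq) (L := KinfAlg Fq))

/-- `ℂ_∞`: the completion of an algebraic closure of `K_∞`. -/
def Cinf := UniformSpace.Completion (KinfAlg Fq)

instance instNFCinf : NormedField (Cinf Fq) :=
  inferInstanceAs (NormedField (UniformSpace.Completion (KinfAlg Fq)))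

instance instCompleteCinf : CompleteSpace (Cinf Fq) :=
  inferInstanceAs (CompleteSpace (UniformSpace.Completion (KinfAlg Fq)))

instance instNACinf : NormedAlgebra (Kinf Fq) (Cinf Fq) :=
  inferInstanceAs (NormedAlgebra (Kinf Fq) (UniformSpace.Completion (KinfAlg Fq)))

instance instUltraCinf : IsUltrametricDist (Cinf Fq) :=
  IsUltrametricDist.of_normedAlgebra (Kinf Fq)

end Fields

/-! ### The upper half-plane, rigid analytic functions, slash operators -/

section UpperHalfPlane

variable (Fq : Type*) [Field Fq] [Finite Fq]

/-- The Drinfeld upper half-plane `Ω = ℙ¹(ℂ_∞) ∖ ℙ¹(K_∞) = ℂ_∞ ∖ K_∞`. -/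
def Omega := {z : Cinf Fq // z ∉ Set.range (algebraMap (Kinf Fq) (Cinf Fq))}

instance : CoeOut (Omega Fq) (Cinf Fq) := ⟨Subtype.val⟩

/-- The embedding of `K = 𝔽_q(T)` into `K_∞`. -/
def toKinf : RatFunc Fq →+* Kinf Fq := algebraMap (RatFunc Fq) (Kinf Fq)

/-- The embedding of `A = 𝔽_q[T]` into `ℂ_∞`. -/
def polyToCinf : Fq[X] →+* Cinf Fq :=
  (algebraMap (Kinf Fq) (Cinf Fq)).comp ((toKinf Fq).comp (algebraMap Fq[X] (RatFunc Fq)))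

/-- `GL₂(K_∞)`. -/
abbrev GLKinf := Matrix.GeneralLinearGroup (Fin 2) (Kinf Fq)

variable {Fq}

/-- The automorphy factor `j(γ, z) = cz + d`. -/
def den (γ : GLKinf Fq) (z : Omega Fq) : Cinf Fq :=
  algebraMap (Kinf Fq) (Cinf Fq) (γ 1 0) * z + algebraMap (Kinf Fq) (Cinf Fq) (γ 1 1)

/-- `az + b`. -/
def num (γ : GLKinf Fq) (z : Omega Fq) : Cinf Fq :=
  algebraMap (Kinf Fq) (Cinf Fq) (γ 0 0) * z + algebraMap (Kinf Fq) (Cinf Fq) (γ 0 1)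

/-- The determinant of `γ`, in `ℂ_∞`. -/
def detC (γ : GLKinf Fq) : Cinf Fq := algebraMap (Kinf Fq) (Cinf Fq) (Matrix.GeneralLinearGroup.det γ : Kinf Fq)

/-- `κ(γ, z) = c / (cz + d)`. -/
def kappa (γ : GLKinf Fq) (z : Omega Fq) : Cinf Fq :=
  algebraMap (Kinf Fq) (Cinf Fq) (γ 1 0) / den γ z

lemma lin_ne_zero (u v : Kinf Fq) (z : Omega Fq)
    (h : algebraMap (Kinf Fq) (Cinf Fq) u * z + algebraMap (Kinf Fq) (Cinf Fq) v = 0) :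
    u = 0 ∧ v = 0 := by
  have hu : u = 0 := by
    by_contra hu
    apply z.2
    have hu' : algebraMap (Kinf Fq) (Cinf Fq) u ≠ 0 := by simpa using hu
    refine ⟨-v / u, ?_⟩
    rw [map_div₀, map_neg, div_eq_iff hu']
    linear_combination -h
  subst hu
  simpa using h

lemma detC_ne_zero (γ : GLKinf Fq) : detC γ ≠ 0 := by
  exact (_root_.map_ne_zero _).2 (Matrix.GeneralLinearGroup.det γ).ne_zero

lemma den_ne_zero (γ : GLKinf Fq) (z : Omega Fq) : den γ z ≠ 0 := by
  intro h
  obtain ⟨h1, h2⟩ := lin_ne_zero _ _ z h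
  have h := (Matrix.GeneralLinearGroup.det γ).ne_zero
  rw [Matrix.GeneralLinearGroup.val_det_apply, Matrix.det_fin_two, h1, h2] at h
  simp at h

/-- The action of `GL₂(K_∞)` on `Ω` by fractional linear transformations. -/
def mob (γ : GLKinf Fq) (z : Omega Fq) : Omega Fq :=
  ⟨num γ z / den γ z, by
    rintro ⟨x, hx⟩
    rw [eq_div_iff (den_ne_zero γ z)] at hx
    have h0 : algebraMap (Kinf Fq) (Cinf Fq) (γ 0 0 - x * γ 1 0) * z +
        algebraMap (Kinf Fq) (Cinf Fq) (γ 0 1 - x * γ 1 1) = 0 := by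
      simp only [map_sub, map_mul, num, den] at hx ⊢
      linear_combination -hx
    obtain ⟨h1, h2⟩ := lin_ne_zero _ _ z h0
    have h := (Matrix.GeneralLinearGroup.det γ).ne_zero
    rw [Matrix.GeneralLinearGroup.val_det_apply, Matrix.det_fin_two] at h
    exact h (by linear_combination γ 1 1 * h1 - γ 1 0 * h2)⟩

/-- The slash operator `(f |_{k,m} γ)(z) = (det γ)^m (cz+d)^{-k} f(γ z)`. -/
def slash (k m : ℤ) (γ : GLKinf Fq) (f : Omega Fq → Cinf Fq) : Omega Fq → Cinf Fq :=
  fun z => detC γ ^ m * den γ z ^ (-k) * f (mob γ z)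

variable (Fq)

/-- The affinoid `Ω_n = {z : |z| ≤ q^n, |z - x| ≥ q^{-n} for all x ∈ K_∞}`; these form an
admissible covering of `Ω`. -/
def omegaN (n : ℕ) : Set (Omega Fq) :=
  {z | ‖(z : Cinf Fq)‖ ≤ (Nat.card Fq : ℝ) ^ n ∧
    ∀ x : Kinf Fq, ((Nat.card Fq : ℝ) ^ n)⁻¹ ≤ ‖(z : Cinf Fq) - algebraMap (Kinf Fq) (Cinf Fq) x‖}

/-- Functions on `Ω` given by a rational function over `ℂ_∞` without poles in `Ω_n`: as `ℂ_∞` is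
algebraically closed these are generated by `z` and the `(z - α)⁻¹` with `α ∉ Ω_n`. -/
def ratAlg (n : ℕ) : Subalgebra (Cinf Fq) (Omega Fq → Cinf Fq) :=
  Algebra.adjoin (Cinf Fq)
    ({fun z : Omega Fq => (z : Cinf Fq)} ∪
      {f | ∃ α : Cinf Fq, (∀ z ∈ omegaN Fq n, (z : Cinf Fq) ≠ α) ∧
        f = fun z : Omega Fq => ((z : Cinf Fq) - α)⁻¹})

variable {Fq}

/-- A rigid analytic function on `Ω`: on each `Ω_n` it is a uniform limit of rational functions
without poles in `Ω_n`. -/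
def IsRigid (f : Omega Fq → Cinf Fq) : Prop :=
  ∀ n : ℕ, ∀ ε : ℝ, 0 < ε → ∃ r ∈ ratAlg Fq n, ∀ z ∈ omegaN Fq n, ‖f z - r z‖ ≤ ε

/-- `f` is `I`-periodic for some nonzero ideal `I` of `A`. -/
def IsPeriodic (f : Omega Fq → Cinf Fq) : Prop :=
  ∃ I : Ideal Fq[X], I ≠ ⊥ ∧ ∀ a ∈ I, ∀ z w : Omega Fq,
    (w : Cinf Fq) = z + polyToCinf Fq a → f w = f z

lemma exists_lower_bound (n : ℕ) (α : Cinf Fq) (hα : ∀ z ∈ omegaN Fq n, (z : Cinf Fq) ≠ α)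
    (z : Omega Fq) (hz : z ∈ omegaN Fq n) :
    ((Nat.card Fq : ℝ) ^ n)⁻¹ ≤ ‖(z : Cinf Fq) - α‖ := by
  have hq : (1 : ℝ) ≤ (Nat.card Fq : ℝ) ^ n :=
    one_le_pow₀ (by exact_mod_cast Finite.one_lt_card.le)
  have hq' : ((Nat.card Fq : ℝ) ^ n)⁻¹ ≤ (Nat.card Fq : ℝ) ^ n :=
    (inv_le_one_of_one_le₀ hq).trans hq
  by_contra hlt
  push Not at hlt
  have hx : ∀ x : Kinf Fq, ((Nat.card Fq : ℝ) ^ n)⁻¹ ≤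
      ‖α - algebraMap (Kinf Fq) (Cinf Fq) x‖ := by
    intro x
    by_contra hx
    push Not at hx
    have h1 := IsUltrametricDist.norm_add_le_max ((z : Cinf Fq) - α)
      (α - algebraMap (Kinf Fq) (Cinf Fq) x)
    rw [sub_add_sub_cancel] at h1
    exact absurd ((hz.2 x).trans h1) (not_le.2 (max_lt hlt hx))
  have hα1 : ‖α‖ ≤ (Nat.card Fq : ℝ) ^ n := by
    have h1 := IsUltrametricDist.norm_add_le_max (-((z : Cinf Fq) - α)) (z : Cinf Fq)
    rw [norm_neg, neg_sub, sub_add_cancel] at h1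
    exact h1.trans (max_le (hlt.le.trans hq') hz.1)
  refine hα ⟨α, ?_⟩ ⟨hα1, hx⟩ rfl
  rintro ⟨x, rfl⟩
  have := hx x
  simp only [sub_self, norm_zero] at this
  exact absurd this (not_le.2 (inv_pos.2 (lt_of_lt_of_le one_pos hq)))

lemma ratAlg_bounded (n : ℕ) (r : Omega Fq → Cinf Fq) (hr : r ∈ ratAlg Fq n) :
    ∃ B : ℝ, 0 < B ∧ ∀ z ∈ omegaN Fq n, ‖r z‖ ≤ B := by
  have hq : (0 : ℝ) < (Nat.card Fq : ℝ) ^ n :=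
    pow_pos (by exact_mod_cast Nat.card_pos) n
  induction hr using Algebra.adjoin_induction with
  | mem f hf =>
    refine ⟨(Nat.card Fq : ℝ) ^ n, hq, fun z hz => ?_⟩
    rcases hf with hf | ⟨α, hα, hf⟩
    · rw [Set.mem_singleton_iff] at hf
      subst hf
      exact hz.1
    · subst hf
      simp only [norm_inv]
      exact inv_le_of_inv_le₀ hq (exists_lower_bound n α hα z hz)
  | algebraMap c =>
    refine ⟨‖c‖ + 1, by positivity, fun z _ => ?_⟩
    change ‖c‖ ≤ _
    linarith
  | add f g _ _ hf hg =>
    obtain ⟨B, hB, h1⟩ := hf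
    obtain ⟨B', hB', h2⟩ := hg
    exact ⟨B + B', by positivity, fun z hz =>
      (norm_add_le _ _).trans (add_le_add (h1 z hz) (h2 z hz))⟩
  | mul f g _ _ hf hg =>
    obtain ⟨B, hB, h1⟩ := hf
    obtain ⟨B', hB', h2⟩ := hg
    refine ⟨B * B', by positivity, fun z hz => ?_⟩
    rw [Pi.mul_apply, norm_mul]
    exact mul_le_mul (h1 z hz) (h2 z hz) (norm_nonneg _) hB.le

lemma IsRigid.add {f g : Omega Fq → Cinf Fq} (hf : IsRigid f) (hg : IsRigid g) :
    IsRigid (f + g) := by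
  intro n ε hε
  obtain ⟨r, hr, h1⟩ := hf n (ε / 2) (by positivity)
  obtain ⟨s, hs, h2⟩ := hg n (ε / 2) (by positivity)
  refine ⟨r + s, add_mem hr hs, fun z hz => ?_⟩
  have : (f + g) z - (r + s) z = (f z - r z) + (g z - s z) := by
    simp only [Pi.add_apply]; ring
  rw [this]
  linarith [norm_add_le (f z - r z) (g z - s z), h1 z hz, h2 z hz]

lemma IsRigid.mul {f g : Omega Fq → Cinf Fq} (hf : IsRigid f) (hg : IsRigid g) :
    IsRigid (f * g) := by
  intro n ε hε
  obtain ⟨s0, hs0, h0⟩ := hg n 1 one_pos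
  obtain ⟨B, hB, hB'⟩ := ratAlg_bounded n s0 hs0
  obtain ⟨r, hr, h1⟩ := hf n (ε / 2 / (B + 1)) (by positivity)
  obtain ⟨R, hR, hR'⟩ := ratAlg_bounded n r hr
  obtain ⟨s, hs, h2⟩ := hg n (ε / 2 / R) (by positivity)
  refine ⟨r * s, mul_mem hr hs, fun z hz => ?_⟩
  have hgz : ‖g z‖ ≤ B + 1 := by
    have : g z = (g z - s0 z) + s0 z := by ring
    rw [this]
    linarith [norm_add_le (g z - s0 z) (s0 z), h0 z hz, hB' z hz]
  have : (f * g) z - (r * s) z = (f z - r z) * g z + r z * (g z - s z) := by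
    simp only [Pi.mul_apply]; ring
  rw [this]
  refine (norm_add_le _ _).trans ?_
  rw [norm_mul, norm_mul]
  have e1 : ‖f z - r z‖ * ‖g z‖ ≤ ε / 2 / (B + 1) * (B + 1) :=
    mul_le_mul (h1 z hz) hgz (norm_nonneg _) (by positivity)
  have e2 : ‖r z‖ * ‖g z - s z‖ ≤ R * (ε / 2 / R) :=
    mul_le_mul (hR' z hz) (h2 z hz) (norm_nonneg _) hR.le
  rw [div_mul_cancel₀ _ (by positivity)] at e1
  rw [mul_div_cancel₀ _ hR.ne'] at e2
  linarith

lemma IsRigid.algebraMap (c : Cinf Fq) :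
    IsRigid (algebraMap (Cinf Fq) (Omega Fq → Cinf Fq) c) := by
  intro n ε hε
  exact ⟨_, (ratAlg Fq n).algebraMap_mem c, fun z _ => by simpa using hε.le⟩

lemma IsPeriodic.map₂ {f g : Omega Fq → Cinf Fq} (hf : IsPeriodic f) (hg : IsPeriodic g)
    (op : Cinf Fq → Cinf Fq → Cinf Fq) : IsPeriodic (fun z => op (f z) (g z)) := by
  obtain ⟨I, hI, h1⟩ := hf
  obtain ⟨J, hJ, h2⟩ := hg
  refine ⟨I * J, mul_ne_zero hI hJ, fun a ha z w hzw => ?_⟩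
  have h := Ideal.mul_le_inf ha
  simp only
  rw [h1 a h.1 z w hzw, h2 a h.2 z w hzw]

variable (Fq)

/-- The ring `𝒪` of rigid analytic functions on `Ω` that are `I`-periodic for some nonzero
ideal `I` of `A`. -/
def ringO : Subalgebra (Cinf Fq) (Omega Fq → Cinf Fq) where
  carrier := {f | IsRigid f ∧ IsPeriodic f}
  mul_mem' hf hg := ⟨hf.1.mul hg.1, hf.2.map₂ hg.2 (· * ·)⟩
  add_mem' hf hg := ⟨hf.1.add hg.1, hf.2.map₂ hg.2 (· + ·)⟩
  algebraMap_mem' c := ⟨IsRigid.algebraMap c, ⊤, top_ne_bot, fun _ _ _ _ _ => rfl⟩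

variable {Fq}

/-- Evaluation of functions at a point `z`, as a ring homomorphism. -/
def evalAt (z : Omega Fq) : (Omega Fq → Cinf Fq) →+* Cinf Fq := Pi.evalRingHom _ z

/-- The double-slash operator on polynomials:
`(P ∥_{k,m} γ)(z, X) = (det γ)^m (cz+d)^{-k} P(γ z, (cz+d)²/det γ · (X - c/(cz+d)))`.
For `P = ∑ fᵢ Xⁱ` and a point `z`, the polynomial `P(z, X)` is `P.map (evalAt z)`. -/
def dslash (k m : ℤ) (γ : GLKinf Fq) (P : (Omega Fq → Cinf Fq)[X]) (z : Omega Fq) :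
    (Cinf Fq)[X] :=
  C (detC γ ^ m * den γ z ^ (-k)) *
    (P.map (evalAt (mob γ z))).comp (C (den γ z ^ 2 / detC γ) * (X - C (kappa γ z)))

end UpperHalfPlane

/-! ### Arithmetic subgroups of congruence type -/

section Groups

variable (Fq : Type*) [Field Fq]

/-- `GL₂(K)` for `K = 𝔽_q(T)`. -/
abbrev GLK := Matrix.GeneralLinearGroup (Fin 2) (RatFunc Fq)

/-- `GL₂(A)` as a subgroup of `GL₂(K)`. -/
def GLA : Subgroup (GLK Fq) :=
  (Matrix.GeneralLinearGroup.map (n := Fin 2) (algebraMap Fq[X] (RatFunc Fq))).range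

variable {Fq}

/-- The principal congruence subgroup `Γ(𝔪)`: matrices in `GL₂(A)` congruent to the identity
modulo `𝔪`, as a subgroup of `GL₂(K)`. -/
def principal (𝔪 : Ideal Fq[X]) : Subgroup (GLK Fq) :=
  (Matrix.GeneralLinearGroup.map (n := Fin 2) (Ideal.Quotient.mk 𝔪)).ker.map
    (Matrix.GeneralLinearGroup.map (n := Fin 2) (algebraMap Fq[X] (RatFunc Fq)))

/-- Arithmetic subgroups of congruence type of `GL₂(K)`. -/
def IsArithmeticCongruence (Γ : Subgroup (GLK Fq)) : Prop :=
  Subgroup.Commensurable Γ (GLA Fq) ∧ ∃ 𝔪 : Ideal Fq[X], 𝔪 ≠ ⊥ ∧ principal 𝔪 ≤ Γ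

/-- The embedding `GL₂(K) → GL₂(K_∞)`. -/
def toGL : GLK Fq →* GLKinf Fq := Matrix.GeneralLinearGroup.map (n := Fin 2) (toKinf Fq)

end Groups

/-! ### Quasi-modular functions, weakly quasi-modular polynomials, `E`-expansions -/

section Spaces

variable {Fq : Type*} [Field Fq] [Finite Fq]

/-- `P = ∑ fᵢ Xⁱ ∈ 𝒪[X]` is an associated polynomial of `f` (in weight `k`, type `m`, for `Γ`):
`(f |_{k,m} γ)(z) = ∑ fᵢ(z) (c/(cz+d))ⁱ` for all `γ ∈ Γ` and all `z ∈ Ω`. -/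
structure IsAssocPoly (Γ : Subgroup (GLK Fq)) (k m : ℤ) (f : Omega Fq → Cinf Fq)
    (P : (Omega Fq → Cinf Fq)[X]) : Prop where
  coeff_mem : ∀ i, P.coeff i ∈ ringO Fq
  slash_eq : ∀ γ ∈ Γ, ∀ z : Omega Fq,
    slash k m (toGL γ) f z = ∑ i ∈ Finset.range (P.natDegree + 1),
      P.coeff i z * kappa (toGL γ) z ^ i

variable {Γ : Subgroup (GLK Fq)} {k m k' m' : ℤ} {f g : Omega Fq → Cinf Fq}
  {P Q : (Omega Fq → Cinf Fq)[X]}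

lemma sum_eq_eval (P : (Omega Fq → Cinf Fq)[X]) (z : Omega Fq) (x : Cinf Fq) :
    ∑ i ∈ Finset.range (P.natDegree + 1), P.coeff i z * x ^ i = (P.map (evalAt z)).eval x := by
  rw [eval_map, eval₂_eq_sum_range]
  rfl

lemma coeff_mul_mem (hP : ∀ i, P.coeff i ∈ ringO Fq) (hQ : ∀ i, Q.coeff i ∈ ringO Fq) (i : ℕ) :
    (P * Q).coeff i ∈ ringO Fq := by
  rw [coeff_mul]
  exact sum_mem fun x _ => mul_mem (hP _) (hQ _)

lemma IsAssocPoly.add (hf : IsAssocPoly Γ k m f P) (hg : IsAssocPoly Γ k m g Q) :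
    IsAssocPoly Γ k m (f + g) (P + Q) where
  coeff_mem i := by
    rw [coeff_add]
    exact add_mem (hf.coeff_mem i) (hg.coeff_mem i)
  slash_eq γ hγ z := by
    have h1 := hf.slash_eq γ hγ z
    have h2 := hg.slash_eq γ hγ z
    rw [sum_eq_eval] at h1 h2 ⊢
    rw [Polynomial.map_add, eval_add, ← h1, ← h2]
    simp only [slash, Pi.add_apply]
    ring

lemma IsAssocPoly.mul (hf : IsAssocPoly Γ k m f P) (hg : IsAssocPoly Γ k' m' g Q) :
    IsAssocPoly Γ (k + k') (m + m') (f * g) (P * Q) where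
  coeff_mem := coeff_mul_mem hf.coeff_mem hg.coeff_mem
  slash_eq γ hγ z := by
    have h1 := hf.slash_eq γ hγ z
    have h2 := hg.slash_eq γ hγ z
    rw [sum_eq_eval] at h1 h2 ⊢
    rw [Polynomial.map_mul, eval_mul, ← h1, ← h2]
    simp only [slash, Pi.mul_apply, neg_add, zpow_add₀ (detC_ne_zero (toGL γ)),
      zpow_add₀ (den_ne_zero (toGL γ) z)]
    ring

lemma IsAssocPoly.smul (c : Cinf Fq) (hf : IsAssocPoly Γ k m f P) :
    IsAssocPoly Γ k m (c • f) (c • P) where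
  coeff_mem i := by
    rw [coeff_smul]
    exact (ringO Fq).smul_mem (hf.coeff_mem i) c
  slash_eq γ hγ z := by
    have h1 := hf.slash_eq γ hγ z
    rw [sum_eq_eval] at h1 ⊢
    have h2 : (c • P).map (evalAt z) = C c * P.map (evalAt z) := by
      ext i
      simp [evalAt]
    rw [h2, eval_mul, eval_C, ← h1]
    simp only [slash, Pi.smul_apply, smul_eq_mul]
    ring

variable (Γ k m)

lemma IsAssocPoly.zero : IsAssocPoly Γ k m 0 0 where
  coeff_mem i := by simp
  slash_eq γ hγ z := by simp [slash]

lemma IsAssocPoly.one : IsAssocPoly Γ 0 0 1 1 where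
  coeff_mem i := by
    rw [coeff_one]
    split_ifs
    · exact one_mem _
    · exact zero_mem _
  slash_eq γ hγ z := by
    rw [sum_eq_eval]
    simp [slash]

/-- Quasi-modular functions of weight `k`, type `m` and depth at most `ℓ` for `Γ`. -/
def QML (ℓ : ℕ) : Submodule (Cinf Fq) (Omega Fq → Cinf Fq) where
  carrier := {f | IsRigid f ∧ ∃ P, IsAssocPoly Γ k m f P ∧ P.natDegree ≤ ℓ}
  zero_mem' := ⟨(ringO Fq).zero_mem.1, 0, .zero Γ k m, by simp⟩
  add_mem' := by
    rintro f g ⟨hf, P, hP, hPℓ⟩ ⟨hg, Q, hQ, hQℓ⟩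
    exact ⟨hf.add hg, P + Q, hP.add hQ, natDegree_add_le_of_degree_le hPℓ hQℓ⟩
  smul_mem' := by
    rintro c f ⟨hf, P, hP, hPℓ⟩
    refine ⟨?_, c • P, hP.smul c, (natDegree_smul_le c P).trans hPℓ⟩
    rw [Algebra.smul_def]
    exact (IsRigid.algebraMap c).mul hf

lemma QML_mono {ℓ ℓ' : ℕ} (h : ℓ ≤ ℓ') : QML Γ k m ℓ ≤ QML Γ k m ℓ' :=
  fun _ ⟨hf, P, hP, hPℓ⟩ => ⟨hf, P, hP, hPℓ.trans h⟩

/-- Quasi-modular functions of weight `k` and type `m` for `Γ`, of any depth. -/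
def QM : Submodule (Cinf Fq) (Omega Fq → Cinf Fq) where
  carrier := ⋃ ℓ : ℕ, (QML Γ k m ℓ : Set (Omega Fq → Cinf Fq))
  zero_mem' := Set.mem_iUnion.2 ⟨0, zero_mem _⟩
  add_mem' := by
    intro f g hf hg
    obtain ⟨i, hi⟩ := Set.mem_iUnion.1 hf
    obtain ⟨j, hj⟩ := Set.mem_iUnion.1 hg
    exact Set.mem_iUnion.2 ⟨max i j, add_mem (QML_mono Γ k m (le_max_left i j) hi)
      (QML_mono Γ k m (le_max_right i j) hj)⟩
  smul_mem' := by
    intro c f hf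
    obtain ⟨i, hi⟩ := Set.mem_iUnion.1 hf
    exact Set.mem_iUnion.2 ⟨i, Submodule.smul_mem _ c hi⟩

/-- Modular functions `W_{k,m}(Γ)`: quasi-modular functions of depth `0`. -/
def MF : Submodule (Cinf Fq) (Omega Fq → Cinf Fq) := QML Γ k m 0

/-- Weakly quasi-modular polynomials of weight `k`, type `m` and depth at most `ℓ` for `Γ`. -/
def WPL (ℓ : ℕ) : Submodule (Cinf Fq) (Omega Fq → Cinf Fq)[X] where
  carrier := {P | (∀ i, P.coeff i ∈ ringO Fq) ∧ P.natDegree ≤ ℓ ∧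
    ∀ γ ∈ Γ, ∀ z : Omega Fq, dslash k m (toGL γ) P z = P.map (evalAt z)}
  zero_mem' := ⟨fun i => by simp, by simp, fun γ _ z => by simp [dslash]⟩
  add_mem' := by
    rintro P Q ⟨hP, hPℓ, hPi⟩ ⟨hQ, hQℓ, hQi⟩
    refine ⟨fun i => ?_, natDegree_add_le_of_degree_le hPℓ hQℓ, fun γ hγ z => ?_⟩
    · rw [coeff_add]
      exact add_mem (hP i) (hQ i)
    · rw [Polynomial.map_add, ← hPi γ hγ z, ← hQi γ hγ z]
      simp only [dslash, Polynomial.map_add, add_comp]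
      ring
  smul_mem' := by
    rintro c P ⟨hP, hPℓ, hPi⟩
    have h2 : ∀ z, (c • P).map (evalAt z) = C c * P.map (evalAt z) := by
      intro z
      ext i
      simp [evalAt]
    refine ⟨fun i => ?_, (natDegree_smul_le c P).trans hPℓ, fun γ hγ z => ?_⟩
    · rw [coeff_smul]
      exact (ringO Fq).smul_mem (hP i) c
    · rw [h2, ← hPi γ hγ z]
      simp only [dslash, h2, mul_comp, C_comp]
      ring

lemma WPL_mono {ℓ ℓ' : ℕ} (h : ℓ ≤ ℓ') : WPL Γ k m ℓ ≤ WPL Γ k m ℓ' :=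
  fun _ ⟨hP, hPℓ, hPi⟩ => ⟨hP, hPℓ.trans h, hPi⟩

/-- Weakly quasi-modular polynomials of weight `k` and type `m` for `Γ`, of any depth. -/
def WP : Submodule (Cinf Fq) (Omega Fq → Cinf Fq)[X] where
  carrier := ⋃ ℓ : ℕ, (WPL Γ k m ℓ : Set (Omega Fq → Cinf Fq)[X])
  zero_mem' := Set.mem_iUnion.2 ⟨0, zero_mem _⟩
  add_mem' := by
    intro f g hf hg
    obtain ⟨i, hi⟩ := Set.mem_iUnion.1 hf
    obtain ⟨j, hj⟩ := Set.mem_iUnion.1 hg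
    exact Set.mem_iUnion.2 ⟨max i j, add_mem (WPL_mono Γ k m (le_max_left i j) hi)
      (WPL_mono Γ k m (le_max_right i j) hj)⟩
  smul_mem' := by
    intro c f hf
    obtain ⟨i, hi⟩ := Set.mem_iUnion.1 hf
    exact Set.mem_iUnion.2 ⟨i, Submodule.smul_mem _ c hi⟩

/-- `⨁_{i ≥ 0} W_{k-2i,m-i}(Γ) Eⁱ`, with `E` a formal symbol: the finite sequences `(gᵢ)` with
`gᵢ ∈ W_{k-2i,m-i}(Γ)`, written as polynomials `∑ gᵢ Xⁱ`; the variable stands for `E`. -/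
def EX : Submodule (Cinf Fq) (Omega Fq → Cinf Fq)[X] where
  carrier := {Q | ∀ i : ℕ, Q.coeff i ∈ MF Γ (k - 2 * i) (m - i)}
  zero_mem' i := by simp
  add_mem' {P Q} hP hQ i := by
    rw [coeff_add]
    exact add_mem (hP i) (hQ i)
  smul_mem' c P hP i := by
    rw [coeff_smul]
    exact Submodule.smul_mem _ c (hP i)

/-- `⨁_{i = 0}^ℓ W_{k-2i,m-i}(Γ) Eⁱ`. -/
def EXL (ℓ : ℕ) : Submodule (Cinf Fq) (Omega Fq → Cinf Fq)[X] where
  carrier := {Q | Q ∈ EX Γ k m ∧ Q.natDegree ≤ ℓ}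
  zero_mem' := ⟨zero_mem _, by simp⟩
  add_mem' hP hQ := ⟨add_mem hP.1 hQ.1, natDegree_add_le_of_degree_le hP.2 hQ.2⟩
  smul_mem' c P hP := ⟨Submodule.smul_mem _ c hP.1, (natDegree_smul_le c P).trans hP.2⟩

variable {Γ k m}

lemma QML_mul {ℓ ℓ' : ℕ} (hf : f ∈ QML Γ k m ℓ) (hg : g ∈ QML Γ k' m' ℓ') :
    f * g ∈ QML Γ (k + k') (m + m') (ℓ + ℓ') := by
  obtain ⟨hf, P, hP, hPℓ⟩ := hf
  obtain ⟨hg, Q, hQ, hQℓ⟩ := hg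
  exact ⟨hf.mul hg, P * Q, hP.mul hQ, natDegree_mul_le_of_le hPℓ hQℓ⟩

variable (Γ) in
lemma one_mem_QML (ℓ : ℕ) : (1 : Omega Fq → Cinf Fq) ∈ QML Γ 0 0 ℓ :=
  ⟨(ringO Fq).one_mem.1, 1, .one Γ, by simp⟩

lemma WPL_mul {ℓ ℓ' : ℕ} (hP : P ∈ WPL Γ k m ℓ) (hQ : Q ∈ WPL Γ k' m' ℓ') :
    P * Q ∈ WPL Γ (k + k') (m + m') (ℓ + ℓ') := by
  obtain ⟨hP, hPℓ, hPi⟩ := hP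
  obtain ⟨hQ, hQℓ, hQi⟩ := hQ
  refine ⟨coeff_mul_mem hP hQ, natDegree_mul_le_of_le hPℓ hQℓ, fun γ hγ z => ?_⟩
  rw [Polynomial.map_mul, ← hPi γ hγ z, ← hQi γ hγ z]
  simp only [dslash, Polynomial.map_mul, mul_comp, neg_add, zpow_add₀ (detC_ne_zero (toGL γ)),
      zpow_add₀ (den_ne_zero (toGL γ) z), C_mul]
  ring

variable (Γ) in
lemma one_mem_WPL (ℓ : ℕ) : (1 : (Omega Fq → Cinf Fq)[X]) ∈ WPL Γ 0 0 ℓ :=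
  ⟨(IsAssocPoly.one Γ).coeff_mem, by simp, fun γ _ z => by simp [dslash]⟩

lemma EX_mul (hP : P ∈ EX Γ k m) (hQ : Q ∈ EX Γ k' m') : P * Q ∈ EX Γ (k + k') (m + m') := by
  intro n
  rw [coeff_mul]
  refine sum_mem fun x hx => ?_
  have h := QML_mul (hP x.1) (hQ x.2)
  rw [Finset.HasAntidiagonal.mem_antidiagonal] at hx
  have e1 : k - 2 * (x.1 : ℤ) + (k' - 2 * (x.2 : ℤ)) = k + k' - 2 * (n : ℤ) := by
    rw [← hx]; push_cast; ring
  have e2 : m - (x.1 : ℤ) + (m' - (x.2 : ℤ)) = m + m' - (n : ℤ) := by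
    rw [← hx]; push_cast; ring
  rw [e1, e2] at h
  exact h

variable (Γ) in
lemma one_mem_EX : (1 : (Omega Fq → Cinf Fq)[X]) ∈ EX Γ 0 0 := by
  intro i
  rw [coeff_one]
  split_ifs with h
  · subst h
    simpa [MF] using one_mem_QML Γ 0
  · exact zero_mem _

variable (Γ) in
lemma X_mem_EX : (X : (Omega Fq → Cinf Fq)[X]) ∈ EX Γ 2 1 := by
  intro i
  rw [coeff_X]
  split_ifs with h
  · subst h
    simpa [MF] using one_mem_QML Γ 0
  · exact zero_mem _

end Spaces

/-! ### The bigraded algebras -/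

section Graded

variable {Fq : Type*} [Field Fq] [Finite Fq] (Γ : Subgroup (GLK Fq))

/-- The family `(k, m) ↦ W̃_{k,m}(Γ)` of quasi-modular functions. -/
def grQM (i : ℤ × ℤ) : Submodule (Cinf Fq) (Omega Fq → Cinf Fq) := QM Γ i.1 i.2

/-- The family `(k, m) ↦ ⨁ W_{k-2i,m-i}(Γ) Eⁱ` of `E`-expansions. -/
def grEX (i : ℤ × ℤ) : Submodule (Cinf Fq) (Omega Fq → Cinf Fq)[X] := EX Γ i.1 i.2

/-- The family `(k, m) ↦ 𝒲𝒫_{k,m}(Γ)` of weakly quasi-modular polynomials. -/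
def grWP (i : ℤ × ℤ) : Submodule (Cinf Fq) (Omega Fq → Cinf Fq)[X] := WP Γ i.1 i.2

instance : SetLike.GradedMonoid (grQM Γ) where
  one_mem := Set.mem_iUnion.2 ⟨0, one_mem_QML Γ 0⟩
  mul_mem i j f g hf hg := by
    obtain ⟨a, ha⟩ := Set.mem_iUnion.1 hf
    obtain ⟨b, hb⟩ := Set.mem_iUnion.1 hg
    exact Set.mem_iUnion.2 ⟨a + b, QML_mul ha hb⟩

instance : SetLike.GradedMonoid (grEX Γ) where
  one_mem := one_mem_EX Γ
  mul_mem _ _ _ _ hf hg := EX_mul hf hg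

instance : SetLike.GradedMonoid (grWP Γ) where
  one_mem := Set.mem_iUnion.2 ⟨0, one_mem_WPL Γ 0⟩
  mul_mem i j f g hf hg := by
    obtain ⟨a, ha⟩ := Set.mem_iUnion.1 hf
    obtain ⟨b, hb⟩ := Set.mem_iUnion.1 hg
    exact Set.mem_iUnion.2 ⟨a + b, WPL_mul ha hb⟩

/-- The bigraded algebra `W̃(Γ) = ⨁_{k,m} W̃_{k,m}(Γ)` of quasi-modular functions. -/
abbrev AlgQM := ⨁ i : ℤ × ℤ, grQM Γ i

/-- The bigraded algebra `⨁_{k,m} ⨁_i W_{k-2i,m-i}(Γ) Eⁱ` of `E`-expansions. -/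
abbrev AlgEX := ⨁ i : ℤ × ℤ, grEX Γ i

/-- The bigraded algebra `𝒲𝒫(Γ) = ⨁_{k,m} 𝒲𝒫_{k,m}(Γ)`. -/
abbrev AlgWP := ⨁ i : ℤ × ℤ, grWP Γ i

/-- The depth filtration on `W̃(Γ)`: all components have depth at most `ℓ`. -/
def filQM (ℓ : ℕ) : Submodule (Cinf Fq) (AlgQM Γ) where
  carrier := {x | ∀ i, (x i : Omega Fq → Cinf Fq) ∈ QML Γ i.1 i.2 ℓ}
  zero_mem' i := by simp
  add_mem' hx hy i := by simpa using add_mem (hx i) (hy i)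
  smul_mem' c x hx i := by
    rw [DirectSum.smul_apply]
    exact Submodule.smul_mem _ c (hx i)

/-- The depth filtration on `E`-expansions. -/
def filEX (ℓ : ℕ) : Submodule (Cinf Fq) (AlgEX Γ) where
  carrier := {x | ∀ i, (x i : (Omega Fq → Cinf Fq)[X]) ∈ EXL Γ i.1 i.2 ℓ}
  zero_mem' i := by simp
  add_mem' hx hy i := by simpa using add_mem (hx i) (hy i)
  smul_mem' c x hx i := by
    rw [DirectSum.smul_apply]
    exact Submodule.smul_mem _ c (hx i)

/-- The depth filtration on `𝒲𝒫(Γ)`. -/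
def filWP (ℓ : ℕ) : Submodule (Cinf Fq) (AlgWP Γ) where
  carrier := {x | ∀ i, (x i : (Omega Fq → Cinf Fq)[X]) ∈ WPL Γ i.1 i.2 ℓ}
  zero_mem' i := by simp
  add_mem' hx hy i := by simpa using add_mem (hx i) (hy i)
  smul_mem' c x hx i := by
    rw [DirectSum.smul_apply]
    exact Submodule.smul_mem _ c (hx i)

end Graded

/-! ### The false Eisenstein series -/

section Eisenstein

variable {Fq : Type*} [Field Fq] [Finite Fq]

variable (Fq) in
/-- `D_n = ∏_{i<n} (T^{qⁿ} - T^{qⁱ})`. -/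
def carlitzD (n : ℕ) : Fq[X] :=
  ∏ i ∈ Finset.range n, ((X : Fq[X]) ^ (Nat.card Fq ^ n) - X ^ (Nat.card Fq ^ i))

/-- The exponential `e_C(z) = ∑ z^{qⁿ} / D_n` of the Carlitz module `T ↦ T + τ`. -/
def carlitzExp (z : Cinf Fq) : Cinf Fq :=
  ∑' n : ℕ, z ^ (Nat.card Fq ^ n) / polyToCinf Fq (carlitzD Fq n)

/-- A period of the Carlitz module: a generator of the rank one lattice `ker e_C = π̃ A`. -/
def IsCarlitzPeriod (ϖ : Cinf Fq) : Prop :=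
  ϖ ≠ 0 ∧ {z : Cinf Fq | carlitzExp z = 0} = Set.range fun a : Fq[X] => polyToCinf Fq a * ϖ

/-- The false Eisenstein series `E(z) = π̃⁻¹ ∑_{a monic} ∑_{b ∈ A} a / (az + b)`. -/
def falseE (ϖ : Cinf Fq) : Omega Fq → Cinf Fq := fun z =>
  ϖ⁻¹ * ∑' a : {a : Fq[X] // a.Monic}, ∑' b : Fq[X],
    polyToCinf Fq a / (polyToCinf Fq a * z + polyToCinf Fq b)

/-- The polynomial `P_E = E - π̃⁻¹ X`. -/
def polyE (ϖ : Cinf Fq) : (Omega Fq → Cinf Fq)[X] :=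
  C (falseE ϖ) - C (algebraMap (Cinf Fq) (Omega Fq → Cinf Fq) ϖ⁻¹) * X

/-- For `e` in a `ℂ_∞`-algebra `R`, the `ℂ_∞[E]`-algebra structure on `R` in which `E` acts as
multiplication by `e`. -/
@[reducible] def algE {R : Type*} [CommSemiring R] [Algebra (Cinf Fq) R] (e : R) :
    Algebra (Cinf Fq)[X] R :=
  (aeval e : (Cinf Fq)[X] →ₐ[Cinf Fq] R).toRingHom.toAlgebra

end Eisenstein

end DrinfeldQM

end

open DrinfeldQM

noncomputable section

namespace DrinfeldQM

/-! ### Cocycle identities -/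

section Cocycle

variable {Fq : Type*} [Field Fq] [Finite Fq]

/-! Two facts carry the theorem: associated polynomials are rigid, and `E` is quasi-modular.

Rigidity. At a fixed `z` the quantity `κ(γ, z) = c/(cz+d)` takes infinitely many values as `γ` runs
through a congruence subgroup (`infinite_kappa`), so an identity of polynomials in `X` can be tested
at `X = κ(γ, z)`. This gives uniqueness of `P_f` (`IsAssocPoly.unique`) and, through the cocycle
relations, its invariance under the double slash (`IsAssocPoly.mem_WPL`). Conversely, an invariant
`P` evaluated at `X = κ(γ, z)` is associated to its constant coefficient (`isAssocPoly_of_mem_WP`).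
Hence `𝒲𝒫_{k,m}` and `W̃_{k,m}` are the same space, seen through `P ↦ P(z, 0)`.

Expansion. `P_E = E - π̃⁻¹X` has degree one in `X` and a constant leading coefficient, so it has a
compositional inverse `π̃(E - X)`. Composition with `P_E` is `ψ` and composition with the inverse is
`φ`. Both are restrictions of algebra homomorphisms and neither raises degrees, so multiplicativity
and compatibility with depth come for free. In the coordinate `π̃(E - X)` the affine action on `X`
becomes a scaling, and comparing coefficients yields modular functions (`comp_polyEInv_mem_EX`).

Quasi-modularity of `E`. The terms `a/(az+b)` do not tend to zero over all pairs: for fixed `b` they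
approach `1/z` as `|a|` grows. Summing first over `b` modulo constants produces terms that do tend
to zero, uniformly on each `Ω_n` (`norm_groupedTerm_le`), so the grouped sum is rigid analytic. It
can be computed along any exhaustion by finite sets that are eventually stable under constants.
Comparing boxes with their images under `GL₂(A)` gives the transformation law
(`detC_mul_groupedSum_mob`): every term contributes the same error, their number is divisible by the
characteristic, and the missing error at the origin leaves exactly the quasi-modular defect. -/

lemma num_mul (γ δ : GLKinf Fq) (z : Omega Fq) :
    num (γ * δ) z = num γ (mob δ z) * den δ z := by
  have h := den_ne_zero δ z
  simp only [num, mob, Units.val_mul, Matrix.mul_apply, Fin.sum_univ_two, map_add, map_mul]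
  field_simp
  simp only [den]
  ring

lemma den_mul (γ δ : GLKinf Fq) (z : Omega Fq) :
    den (γ * δ) z = den γ (mob δ z) * den δ z := by
  have h := den_ne_zero δ z
  have e : den γ (mob δ z) = algebraMap (Kinf Fq) (Cinf Fq) (γ 1 0) * (num δ z / den δ z) +
      algebraMap (Kinf Fq) (Cinf Fq) (γ 1 1) := rfl
  rw [e, add_mul, mul_assoc, div_mul_cancel₀ _ h]
  simp only [den, num, Units.val_mul, Matrix.mul_apply, Fin.sum_univ_two, map_add, map_mul]
  ring

lemma mob_mul (γ δ : GLKinf Fq) (z : Omega Fq) : mob (γ * δ) z = mob γ (mob δ z) := by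
  apply Subtype.ext
  change num (γ * δ) z / den (γ * δ) z = num γ (mob δ z) / den γ (mob δ z)
  rw [num_mul, den_mul, mul_div_mul_right _ _ (den_ne_zero δ z)]

lemma detC_mul (γ δ : GLKinf Fq) : detC (γ * δ) = detC γ * detC δ := by
  simp [detC]

lemma detC_eq (γ : GLKinf Fq) : detC γ =
    algebraMap (Kinf Fq) (Cinf Fq) (γ 0 0) * algebraMap (Kinf Fq) (Cinf Fq) (γ 1 1) -
    algebraMap (Kinf Fq) (Cinf Fq) (γ 0 1) * algebraMap (Kinf Fq) (Cinf Fq) (γ 1 0) := by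
  rw [detC, Matrix.GeneralLinearGroup.val_det_apply, Matrix.det_fin_two]
  simp

/-- The affine change of variable in `dslash` is designed to carry `κ(γδ, z)` to `κ(γ, δz)`; this is
why evaluation at `κ` intertwines the slash and double-slash actions. After clearing denominators,
all that remains is `e`, an identity between bottom rows. -/
lemma kappa_mob (γ δ : GLKinf Fq) (z : Omega Fq) :
    kappa γ (mob δ z) = den δ z ^ 2 / detC δ * (kappa (γ * δ) z - kappa δ z) := by
  have h1 := den_ne_zero δ z
  have h2 := den_ne_zero γ (mob δ z)
  have h3 := detC_ne_zero δ
  have e : (algebraMap (Kinf Fq) (Cinf Fq) ((γ * δ) 1 0)) * den δ z -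
      algebraMap (Kinf Fq) (Cinf Fq) (δ 1 0) * (den γ (mob δ z) * den δ z) =
      algebraMap (Kinf Fq) (Cinf Fq) (γ 1 0) * detC δ := by
    rw [← den_mul]
    simp only [detC_eq, den, Units.val_mul, Matrix.mul_apply, Fin.sum_univ_two, map_add, map_mul]
    ring
  rw [kappa, kappa, kappa, den_mul]
  field_simp
  linear_combination -e

lemma slash_mul (k m : ℤ) (γ δ : GLKinf Fq) (f : Omega Fq → Cinf Fq) (z : Omega Fq) :
    slash k m (γ * δ) f z = detC δ ^ m * den δ z ^ (-k) * slash k m γ f (mob δ z) := by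
  simp only [slash, detC_mul, den_mul, mob_mul, mul_zpow]
  ring

lemma den_one (z : Omega Fq) : den 1 z = 1 := by simp [den]

lemma mob_one (z : Omega Fq) : mob 1 z = z := by
  apply Subtype.ext
  change num 1 z / den 1 z = z
  rw [den_one]
  simp [num]

lemma slash_one (k m : ℤ) (f : Omega Fq → Cinf Fq) (z : Omega Fq) : slash k m 1 f z = f z := by
  simp [slash, den_one, mob_one, detC]

lemma kappa_one (z : Omega Fq) : kappa 1 z = 0 := by simp [kappa]

end Cocycle

/-! ### Infinitely many values of `κ` at each point -/

section Infinite

variable {Fq : Type*} [Field Fq] [Finite Fq]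

lemma polyToCinf_injective : Function.Injective (polyToCinf Fq) := by
  rw [polyToCinf]
  exact (algebraMap (Kinf Fq) (Cinf Fq)).injective.comp
    ((toKinf Fq).injective.comp (IsFractionRing.injective Fq[X] (RatFunc Fq)))

instance : Infinite (Cinf Fq) := Infinite.of_injective _ polyToCinf_injective

/-- The lower triangular unipotent matrix with entry `c`. -/
def lowerUnipotent {R : Type*} [CommRing R] (c : R) : Matrix.GeneralLinearGroup (Fin 2) R :=
  ⟨!![1, 0; c, 1], !![1, 0; -c, 1], by ext i j; fin_cases i <;> fin_cases j <;> simp,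
    by ext i j; fin_cases i <;> fin_cases j <;> simp⟩

/-- For a fixed nonzero `a ∈ 𝔪`, the matrices with bottom row `(ab, 1)` lie in `Γ(𝔪) ≤ Γ` for every
`b ∈ A`, and `c ↦ c/(cz+1)` is injective. -/
lemma infinite_kappa {Γ : Subgroup (GLK Fq)} (hΓ : IsArithmeticCongruence Γ) (z : Omega Fq) :
    {x : Cinf Fq | ∃ γ ∈ Γ, kappa (toGL γ) z = x}.Infinite := by
  obtain ⟨-, 𝔪, h𝔪, hle⟩ := hΓ
  obtain ⟨a, ha, ha0⟩ := Submodule.exists_mem_ne_zero_of_ne_bot h𝔪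
  have hden (c : Fq[X]) : polyToCinf Fq c * z + 1 ≠ 0 := by
    intro h
    have := (lin_ne_zero (toKinf Fq (algebraMap _ _ c)) 1 z (by rw [map_one]; exact h)).2
    exact one_ne_zero this
  have hinj : Function.Injective fun b : Fq[X] =>
      polyToCinf Fq (a * b) / (polyToCinf Fq (a * b) * z + 1) := by
    intro b b' h
    have h1 := hden (a * b)
    have h2 := hden (a * b')
    simp only at h
    rw [div_eq_div_iff h1 h2] at h
    have h3 : polyToCinf Fq (a * b) = polyToCinf Fq (a * b') := by linear_combination h
    exact mul_left_cancel₀ ha0 (polyToCinf_injective h3)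
  refine (Set.infinite_range_of_injective hinj).mono ?_
  rintro _ ⟨b, rfl⟩
  refine ⟨Matrix.GeneralLinearGroup.map (n := Fin 2) (algebraMap Fq[X] (RatFunc Fq))
    (lowerUnipotent (a * b)), hle (Subgroup.mem_map_of_mem _ ?_), ?_⟩
  · have h0 : Ideal.Quotient.mk 𝔪 (a * b) = 0 :=
      Ideal.Quotient.eq_zero_iff_mem.2 (𝔪.mul_mem_right b ha)
    rw [MonoidHom.mem_ker]
    ext i j
    fin_cases i <;> fin_cases j <;> simp [lowerUnipotent, -map_mul, h0]
  · simp [kappa, den, toGL, lowerUnipotent, polyToCinf]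

end Infinite

/-! ### Associated polynomials and weakly quasi-modular polynomials -/

section Assoc

variable {Fq : Type*} [Field Fq] [Finite Fq] {Γ : Subgroup (GLK Fq)} {k m : ℤ}
  {f : Omega Fq → Cinf Fq} {P Q : (Omega Fq → Cinf Fq)[X]}

lemma poly_ext (h : ∀ z : Omega Fq, P.map (evalAt z) = Q.map (evalAt z)) : P = Q := by
  ext i z
  simpa [evalAt] using congr_arg (fun p => p.coeff i) (h z)

lemma IsAssocPoly.slash_eq_eval (h : IsAssocPoly Γ k m f P) {γ : GLK Fq} (hγ : γ ∈ Γ)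
    (z : Omega Fq) : slash k m (toGL γ) f z = (P.map (evalAt z)).eval (kappa (toGL γ) z) := by
  rw [h.slash_eq γ hγ z, sum_eq_eval]

lemma IsAssocPoly.coeff_zero (h : IsAssocPoly Γ k m f P) : P.coeff 0 = f := by
  funext z
  have := h.slash_eq_eval (one_mem Γ) z
  rw [map_one, slash_one, kappa_one, ← coeff_zero_eq_eval_zero, coeff_map] at this
  exact this.symm

lemma IsAssocPoly.unique (hΓ : IsArithmeticCongruence Γ) (hP : IsAssocPoly Γ k m f P)
    (hQ : IsAssocPoly Γ k m f Q) : P = Q := by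
  refine poly_ext fun z => eq_of_infinite_eval_eq _ _ ((infinite_kappa hΓ z).mono ?_)
  rintro _ ⟨γ, hγ, rfl⟩
  exact (hP.slash_eq_eval hγ z).symm.trans (hQ.slash_eq_eval hγ z)

lemma eval_dslash (γ : GLKinf Fq) (z : Omega Fq) (x : Cinf Fq) :
    (dslash k m γ P z).eval x = detC γ ^ m * den γ z ^ (-k) *
      (P.map (evalAt (mob γ z))).eval (den γ z ^ 2 / detC γ * (x - kappa γ z)) := by
  simp [dslash]

/-- Invariance under `δ` is tested at the infinitely many points `κ(γ, z)`. Writing `γ = (γδ⁻¹)δ`,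
the two sides are the two ways of computing `f | γ` at `z`: directly, and through `γδ⁻¹` at the
point `δz`. -/
lemma IsAssocPoly.mem_WPL (hΓ : IsArithmeticCongruence Γ) (hP : IsAssocPoly Γ k m f P) {ℓ : ℕ}
    (hℓ : P.natDegree ≤ ℓ) : P ∈ WPL Γ k m ℓ := by
  refine ⟨hP.coeff_mem, hℓ, fun δ hδ z => ?_⟩
  refine eq_of_infinite_eval_eq _ _ ((infinite_kappa hΓ z).mono ?_)
  rintro _ ⟨γ, hγ, rfl⟩
  change eval _ _ = eval _ _
  have h := hP.slash_eq_eval (mul_mem hγ (inv_mem hδ)) (mob (toGL δ) z)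
  rw [eval_dslash, ← hP.slash_eq_eval hγ z]
  have e : toGL γ = toGL (γ * δ⁻¹) * toGL δ := by rw [← map_mul, inv_mul_cancel_right]
  rw [e, ← kappa_mob, slash_mul, h]

lemma mem_QM {f : Omega Fq → Cinf Fq} : f ∈ QM Γ k m ↔ ∃ ℓ, f ∈ QML Γ k m ℓ := Set.mem_iUnion

lemma mem_WP {P : (Omega Fq → Cinf Fq)[X]} : P ∈ WP Γ k m ↔ ∃ ℓ, P ∈ WPL Γ k m ℓ :=
  Set.mem_iUnion

lemma mem_WPL_iff_of_mem_WP (hP : P ∈ WP Γ k m) {ℓ : ℕ} :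
    P ∈ WPL Γ k m ℓ ↔ P.natDegree ≤ ℓ := by
  obtain ⟨ℓ', h1, -, h2⟩ := mem_WP.1 hP
  exact ⟨fun h => h.2.1, fun h => ⟨h1, h, h2⟩⟩

/-- At `X = κ(γ, z)` the inner variable of the double slash vanishes, so only the constant
coefficient at `γz` survives. -/
lemma isAssocPoly_of_mem_WP (hP : P ∈ WP Γ k m) : IsAssocPoly Γ k m (P.coeff 0) P := by
  obtain ⟨ℓ, h1, -, h2⟩ := mem_WP.1 hP
  refine ⟨h1, fun γ hγ z => ?_⟩
  rw [sum_eq_eval, ← h2 γ hγ z, eval_dslash, sub_self, mul_zero, ← coeff_zero_eq_eval_zero,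
    coeff_map]
  rfl

lemma isAssocPoly_iff_mem_WP (hΓ : IsArithmeticCongruence Γ) :
    IsAssocPoly Γ k m f P ↔ P ∈ WP Γ k m ∧ P.coeff 0 = f :=
  ⟨fun h => ⟨mem_WP.2 ⟨_, h.mem_WPL hΓ le_rfl⟩, h.coeff_zero⟩,
    fun h => h.2 ▸ isAssocPoly_of_mem_WP h.1⟩

lemma mem_QML_iff (hΓ : IsArithmeticCongruence Γ) {ℓ : ℕ} :
    f ∈ QML Γ k m ℓ ↔ ∃ P ∈ WPL Γ k m ℓ, P.coeff 0 = f := by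
  constructor
  · rintro ⟨-, P, hP, hℓ⟩
    exact ⟨P, hP.mem_WPL hΓ hℓ, hP.coeff_zero⟩
  · rintro ⟨P, hP, rfl⟩
    exact ⟨(hP.1 0).1, P, isAssocPoly_of_mem_WP (mem_WP.2 ⟨ℓ, hP⟩), hP.2.1⟩

lemma mem_MF_iff : f ∈ MF Γ k m ↔ f ∈ ringO Fq ∧ ∀ γ ∈ Γ, ∀ z, slash k m (toGL γ) f z = f z := by
  constructor
  · rintro ⟨-, P, hP, hℓ⟩
    have h0 := hP.coeff_zero
    refine ⟨h0 ▸ hP.coeff_mem 0, fun γ hγ z => ?_⟩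
    rw [hP.slash_eq γ hγ z, Nat.le_zero.1 hℓ]
    simp [h0]
  · rintro ⟨h1, h2⟩
    refine ⟨h1.1, C f, ⟨fun i => ?_, fun γ hγ z => ?_⟩, by simp⟩
    · rw [coeff_C]
      split_ifs
      exacts [h1, zero_mem _]
    · simp [h2 γ hγ z]

lemma isAssocPoly_C (hf : f ∈ MF Γ k m) : IsAssocPoly Γ k m f (C f) := by
  obtain ⟨h1, h2⟩ := mem_MF_iff.1 hf
  refine ⟨fun i => ?_, fun γ hγ z => ?_⟩
  · rw [coeff_C]
    split_ifs
    exacts [h1, zero_mem _]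
  · simp [h2 γ hγ z]

/-- Coefficients in `𝒪` mean that both polynomials lift to polynomials over the subring `𝒪`, where
the composition can be formed. -/
lemma coeff_comp_mem (hP : ∀ i, P.coeff i ∈ ringO Fq) (hQ : ∀ i, Q.coeff i ∈ ringO Fq) (i : ℕ) :
    (P.comp Q).coeff i ∈ ringO Fq := by
  have key (R : (Omega Fq → Cinf Fq)[X]) :
      R ∈ lifts (ringO Fq).toSubring.subtype ↔ ∀ i, R.coeff i ∈ ringO Fq := by
    rw [lifts_iff_coeff_lifts]
    exact forall_congr' fun n => ⟨fun ⟨x, hx⟩ => hx ▸ x.2, fun h => ⟨⟨_, h⟩, rfl⟩⟩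
  obtain ⟨P', rfl⟩ := (mem_lifts _).1 ((key P).2 hP)
  obtain ⟨Q', rfl⟩ := (mem_lifts _).1 ((key Q).2 hQ)
  exact (key _).1 ((mem_lifts _).2 ⟨P'.comp Q', Polynomial.map_comp _ _ _⟩) i

end Assoc

/-! ### The correspondence between `E`-expansions and associated polynomials -/

section Expansion

variable {Fq : Type*} [Field Fq] [Finite Fq] {Γ : Subgroup (GLK Fq)} {k m : ℤ}
  {P Q : (Omega Fq → Cinf Fq)[X]} {ϖ : Cinf Fq}

variable (Fq) in
/-- The constant function with value `c`. -/
abbrev constFun (c : Cinf Fq) : Omega Fq → Cinf Fq := algebraMap (Cinf Fq) (Omega Fq → Cinf Fq) c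

/-- The polynomial `ϖ (E - X)`, inverse to `polyE` under composition. -/
def polyEInv (ϖ : Cinf Fq) : (Omega Fq → Cinf Fq)[X] :=
  C (constFun Fq ϖ) * (C (falseE ϖ) - X)

lemma constFun_mul_inv (hϖ : ϖ ≠ 0) : constFun Fq ϖ * constFun Fq ϖ⁻¹ = 1 := by
  rw [← map_mul, mul_inv_cancel₀ hϖ, map_one]

lemma polyE_comp_polyEInv (hϖ : ϖ ≠ 0) : (polyE ϖ).comp (polyEInv ϖ) = X := by
  have h : (C (constFun Fq ϖ) * C (constFun Fq ϖ⁻¹) : (Omega Fq → Cinf Fq)[X]) = 1 := by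
    rw [← C_mul, constFun_mul_inv hϖ, C_1]
  simp only [polyE, polyEInv, sub_comp, mul_comp, C_comp, X_comp]
  linear_combination (X - C (falseE ϖ)) * h

lemma polyEInv_comp_polyE (hϖ : ϖ ≠ 0) : (polyEInv ϖ).comp (polyE ϖ) = X := by
  have h : (C (constFun Fq ϖ) * C (constFun Fq ϖ⁻¹) : (Omega Fq → Cinf Fq)[X]) = 1 := by
    rw [← C_mul, constFun_mul_inv hϖ, C_1]
  simp only [polyE, polyEInv, sub_comp, mul_comp, C_comp, X_comp]
  linear_combination X * h

lemma natDegree_comp_polyE_le (Q : (Omega Fq → Cinf Fq)[X]) :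
    (Q.comp (polyE ϖ)).natDegree ≤ Q.natDegree := by
  refine natDegree_comp_le.trans (mul_le_of_le_one_right' ?_)
  rw [polyE]
  compute_degree

lemma natDegree_comp_polyEInv_le (Q : (Omega Fq → Cinf Fq)[X]) :
    (Q.comp (polyEInv ϖ)).natDegree ≤ Q.natDegree := by
  refine natDegree_comp_le.trans (mul_le_of_le_one_right' ?_)
  rw [polyEInv]
  compute_degree

lemma coeff_zero_comp_polyE (Q : (Omega Fq → Cinf Fq)[X]) :
    (Q.comp (polyE ϖ)).coeff 0 = Q.eval (falseE ϖ) := by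
  rw [coeff_zero_eq_eval_zero, eval_comp]
  simp [polyE]

lemma coeff_polyE_mem (hE : falseE ϖ ∈ ringO Fq) (i : ℕ) : (polyE ϖ).coeff i ∈ ringO Fq := by
  rw [polyE, coeff_sub, coeff_C, coeff_C_mul, coeff_X]
  refine sub_mem ?_ (mul_mem (Subalgebra.algebraMap_mem _ _) ?_)
  · split_ifs
    exacts [hE, zero_mem _]
  · split_ifs
    exacts [one_mem _, zero_mem _]

lemma coeff_polyEInv_mem (hE : falseE ϖ ∈ ringO Fq) (i : ℕ) :
    (polyEInv ϖ).coeff i ∈ ringO Fq := by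
  rw [polyEInv, coeff_C_mul, coeff_sub, coeff_C, coeff_X]
  refine mul_mem (Subalgebra.algebraMap_mem _ _) (sub_mem ?_ ?_)
  · split_ifs
    exacts [hE, zero_mem _]
  · split_ifs
    exacts [one_mem _, zero_mem _]

lemma isAssocPoly_pow {f : Omega Fq → Cinf Fq} (h : IsAssocPoly Γ k m f P) (n : ℕ) :
    IsAssocPoly Γ (n * k) (n * m) (f ^ n) (P ^ n) := by
  induction n with
  | zero => simpa using IsAssocPoly.one Γ
  | succ n ih =>
    have := ih.mul h
    rw [pow_succ, pow_succ]
    convert this using 1 <;> push_cast <;> ring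

lemma isAssocPoly_sum {ι : Type*} (s : Finset ι) (f : ι → Omega Fq → Cinf Fq)
    (P : ι → (Omega Fq → Cinf Fq)[X]) (h : ∀ i ∈ s, IsAssocPoly Γ k m (f i) (P i)) :
    IsAssocPoly Γ k m (∑ i ∈ s, f i) (∑ i ∈ s, P i) := by
  classical
  induction s using Finset.induction_on with
  | empty => simpa using IsAssocPoly.zero Γ k m
  | insert a s ha ih =>
    rw [Finset.sum_insert ha, Finset.sum_insert ha]
    exact (h a (Finset.mem_insert_self _ _)).add
      (ih fun i hi => h i (Finset.mem_insert_of_mem hi))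

/-- Term by term: a modular function of weight `k - 2i` and type `m - i` has itself as associated
polynomial, and `P_E ^ i` supplies the missing weight `2i` and type `i`. -/
lemma isAssocPoly_comp_polyE (hE : IsAssocPoly Γ 2 1 (falseE ϖ) (polyE ϖ)) (hQ : Q ∈ EX Γ k m) :
    IsAssocPoly Γ k m (Q.eval (falseE ϖ)) (Q.comp (polyE ϖ)) := by
  rw [eval_eq_sum_range, comp, eval₂_eq_sum_range]
  refine isAssocPoly_sum _ _ _ fun i _ => ?_
  have h := (isAssocPoly_C (hQ i)).mul (isAssocPoly_pow hE i)
  have e1 : k - 2 * (i : ℤ) + i * 2 = k := by ring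
  have e2 : m - (i : ℤ) + i * 1 = m := by ring
  rwa [e1, e2] at h

/-- `E` and `X` undergo translations that cancel in `π̃(E - X)`. In this coordinate the action of
`γ` on the variable is scaling by `(cz+d)²/det γ`, so each coefficient transforms on its own, with
weight lowered by `2i` and type by `i`. -/
lemma comp_polyEInv_mem_EX (hϖ : ϖ ≠ 0) (hE : IsAssocPoly Γ 2 1 (falseE ϖ) (polyE ϖ))
    (hP : P ∈ WP Γ k m) : P.comp (polyEInv ϖ) ∈ EX Γ k m := by
  obtain ⟨ℓ, h1, -, h2⟩ := mem_WP.1 hP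
  have hEO : falseE ϖ ∈ ringO Fq := by
    have := hE.coeff_mem 0
    rwa [hE.coeff_zero] at this
  intro i
  refine mem_MF_iff.2 ⟨coeff_comp_mem h1 (coeff_polyEInv_mem hEO) i, fun γ hγ z => ?_⟩
  set g := toGL γ
  have hj := den_ne_zero g z
  have hd := detC_ne_zero g
  have hEz : falseE ϖ (mob g z) =
      den g z ^ 2 / detC g * (falseE ϖ z - ϖ⁻¹ * kappa g z) := by
    have : slash 2 1 g _ z = (Polynomial.map _ _).eval (kappa g z) := hE.slash_eq_eval hγ z
    rw [slash] at this
    simp only [polyE, Polynomial.map_sub, Polynomial.map_mul, map_C, map_X, eval_sub, eval_mul,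
      eval_C, eval_X] at this
    change _ = falseE ϖ z - ϖ⁻¹ * kappa g z at this
    rw [← this, zpow_one, zpow_neg]
    have : den g z ^ (2 : ℤ) = den g z ^ 2 := by norm_cast
    rw [this]
    field_simp
  have hcomp (w : Omega Fq) (x : Cinf Fq) : ((P.comp (polyEInv ϖ)).map (evalAt w)).eval x =
      (P.map (evalAt w)).eval (ϖ * (falseE ϖ w - x)) := by
    rw [Polynomial.map_comp, eval_comp, polyEInv]
    simp only [Polynomial.map_sub, Polynomial.map_mul, map_C, map_X, eval_sub, eval_mul,
      eval_C, eval_X]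
    rfl
  -- Invariance of `P` rewritten in the new coordinate; no translation is left. Any infinite set of
  -- test points will do here, so all of `ℂ_∞` is used.
  have key : C (detC g ^ m * den g z ^ (-k)) * ((P.comp (polyEInv ϖ)).map
      (evalAt (mob g z))).comp (C (den g z ^ 2 / detC g) * X) =
      (P.comp (polyEInv ϖ)).map (evalAt z) := by
    refine eq_of_infinite_eval_eq _ _ (Set.infinite_univ.mono fun x _ => ?_)
    change eval _ _ = eval _ _
    rw [hcomp, ← h2 γ hγ z, eval_dslash, eval_mul, eval_comp, hcomp, hEz]
    simp only [eval_C, eval_mul, eval_X]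
    congr 2
    change _ = den g z ^ 2 / detC g * (_ - kappa g z)
    field_simp
    ring
  have := congr_arg (fun p => p.coeff i) key
  simp only [coeff_C_mul, comp_C_mul_X_coeff, coeff_map] at this
  change _ = (P.comp (polyEInv ϖ)).coeff i z at this
  change _ * ((P.comp (polyEInv ϖ)).coeff i (mob g z) * _) = _ at this
  rw [← this, slash, zpow_sub₀ hd, neg_sub, sub_eq_neg_add, zpow_add₀ hj, div_pow, zpow_natCast,
    zpow_mul, zpow_natCast]
  norm_cast
  field_simp

end Expansion

/-! ### Absolute values of polynomials and of linear forms on the affinoids -/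

section Norms

variable {Fq : Type*} [Field Fq]

lemma valued_toKinf {p : Fq[X]} (hp : p ≠ 0) :
    Valued.v (toKinf Fq (algebraMap _ _ p)) = WithZero.exp (p.natDegree : ℤ) := by
  classical
  let : Valued (RatFunc Fq) ℤᵐ⁰ := RatFunc.inftyValued Fq
  exact (Valued.extensionValuation_apply_coe (K := RatFunc Fq) _).trans
    (RatFunc.inftyValuation.polynomial Fq hp)

variable [Finite Fq]

lemma norm_Kinf (x : Kinf Fq) : ‖x‖ = WithZeroMulInt.toNNReal (e := (Nat.card Fq : ℝ≥0))
    (by exact_mod_cast Nat.card_pos.ne') (Valued.v x) := by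
  rw [← Valuation.embedding_restrict]
  rfl

lemma norm_polyToCinf {p : Fq[X]} (hp : p ≠ 0) :
    ‖polyToCinf Fq p‖ = (Nat.card Fq : ℝ) ^ p.natDegree := by
  change ‖algebraMap (Kinf Fq) (Cinf Fq) (toKinf Fq (algebraMap _ _ p))‖ = _
  rw [norm_algebraMap', norm_Kinf, valued_toKinf hp, WithZeroMulInt.toNNReal_neg_apply _
    WithZero.exp_ne_zero]
  push_cast
  exact zpow_natCast _ _

variable (Fq) in
lemma one_lt_natCard : (1 : ℝ) < Nat.card Fq := by exact_mod_cast Finite.one_lt_card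

lemma one_le_norm_polyToCinf {p : Fq[X]} (hp : p ≠ 0) : 1 ≤ ‖polyToCinf Fq p‖ := by
  rw [norm_polyToCinf hp]
  exact one_le_pow₀ (one_lt_natCard Fq).le

variable (Fq) in
lemma finite_degreeLT (N : ℕ) : {p : Fq[X] | p.degree < N}.Finite := by
  have : Finite (degreeLT Fq N) := Finite.of_equiv _ (degreeLTEquiv Fq N).toEquiv.symm
  refine (Set.toFinite (degreeLT Fq N : Set Fq[X])).subset fun p hp => ?_
  exact mem_degreeLT.2 hp

lemma finite_norm_polyToCinf_le (B : ℝ) : {p : Fq[X] | ‖polyToCinf Fq p‖ ≤ B}.Finite := by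
  obtain ⟨N, hN⟩ := pow_unbounded_of_one_lt B (one_lt_natCard Fq)
  refine (finite_degreeLT Fq N).subset fun p hp => ?_
  by_cases h0 : p = 0
  · simp [h0]
  · rw [Set.mem_ofPred_eq, norm_polyToCinf h0] at hp
    exact (natDegree_lt_iff_degree_lt h0).1
      ((pow_lt_pow_iff_right₀ (one_lt_natCard Fq)).1 (hp.trans_lt hN))

lemma norm_le_norm_X_mul_add_C (p : Fq[X]) (c : Fq) :
    ‖polyToCinf Fq p‖ ≤ ‖polyToCinf Fq (X * p + C c)‖ := by
  by_cases h0 : p = 0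
  · simp [h0]
  · have hd : (X * p + C c).natDegree = p.natDegree + 1 := by
      rw [natDegree_add_C, natDegree_X_mul h0]
    have h1 : X * p + C c ≠ 0 := by
      intro h
      rw [h] at hd
      simp at hd
    rw [norm_polyToCinf h0, norm_polyToCinf h1, hd]
    exact pow_le_pow_right₀ (one_lt_natCard Fq).le (Nat.le_succ _)

/-- The value at `z` of the linear form with coefficients `a`, `b`. -/
abbrev lin (a b : Fq[X]) (z : Omega Fq) : Cinf Fq := polyToCinf Fq a * z + polyToCinf Fq b

lemma lin_eq_zero {a b : Fq[X]} {z : Omega Fq} (h : lin a b z = 0) : a = 0 ∧ b = 0 := by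
  have := lin_ne_zero _ _ z h
  have inj {c : Fq[X]} (hc : toKinf Fq (algebraMap _ _ c) = 0) : c = 0 := by
    apply polyToCinf_injective
    rw [map_zero]
    change algebraMap (Kinf Fq) (Cinf Fq) (toKinf Fq (algebraMap _ _ c)) = 0
    rw [hc, map_zero]
  exact ⟨inj this.1, inj this.2⟩

variable (Fq) in
/-- A lower bound for `|az + b| / max(|a|, |b|)` on the affinoid `Ω_n`. -/
def linBound (n : ℕ) : ℝ := (((Nat.card Fq : ℝ) ^ n) ^ 2)⁻¹

variable (Fq) in
lemma linBound_pos (n : ℕ) : 0 < linBound Fq n := by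
  have := one_lt_natCard Fq
  rw [linBound]
  positivity

/-- With `R = qⁿ`: the point `-b/a` of `K_∞` has distance at least `R⁻¹` from `z`, so `|a| ≤
R|az+b|`. The ultrametric inequality and `|z| ≤ R` then give `|b| ≤ R²|az+b|`. -/
lemma linBound_mul_le_norm_lin {n : ℕ} {z : Omega Fq} (hz : z ∈ omegaN Fq n) (a b : Fq[X]) :
    linBound Fq n * max ‖polyToCinf Fq a‖ ‖polyToCinf Fq b‖ ≤ ‖lin a b z‖ := by
  set R : ℝ := (Nat.card Fq : ℝ) ^ n with hR
  have hR1 : 1 ≤ R := one_le_pow₀ (one_lt_natCard Fq).le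
  have hR0 : 0 < R := by linarith
  have ha : ‖polyToCinf Fq a‖ ≤ R * ‖lin a b z‖ := by
    by_cases h0 : a = 0
    · simp only [h0, map_zero, norm_zero]
      positivity
    have h1 : polyToCinf Fq a ≠ 0 := by
      rw [← norm_pos_iff]
      linarith [one_le_norm_polyToCinf h0]
    set x : Kinf Fq := -toKinf Fq (algebraMap _ _ b) / toKinf Fq (algebraMap _ _ a)
    have hx : algebraMap (Kinf Fq) (Cinf Fq) x = -polyToCinf Fq b / polyToCinf Fq a := by
      rw [map_div₀, map_neg]
      rfl
    have h2 := hz.2 x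
    rw [hx] at h2
    have h3 : lin a b z = polyToCinf Fq a * (z - -polyToCinf Fq b / polyToCinf Fq a) := by
      field_simp
      ring
    rw [h3, norm_mul]
    calc ‖polyToCinf Fq a‖ = R * (‖polyToCinf Fq a‖ * R⁻¹) := by field_simp
      _ ≤ _ := by gcongr
  have hb : ‖polyToCinf Fq b‖ ≤ R ^ 2 * ‖lin a b z‖ := by
    have h1 := IsUltrametricDist.norm_add_le_max (lin a b z) (-(polyToCinf Fq a * z))
    rw [norm_neg, norm_mul, add_comm, lin, neg_add_cancel_left] at h1
    refine h1.trans (max_le ?_ ?_)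
    · exact le_mul_of_one_le_left (norm_nonneg _) (one_le_pow₀ hR1)
    · calc ‖polyToCinf Fq a‖ * ‖(z : Cinf Fq)‖ ≤ R * ‖lin a b z‖ * R := by
            gcongr
            exact hz.1
        _ = _ := by ring
  rw [linBound, inv_mul_le_iff₀ (by positivity)]
  refine max_le (ha.trans ?_) hb
  gcongr
  exact le_self_pow₀ hR1 two_ne_zero

/-- `K_∞` is complete, hence closed in `ℂ_∞`, so `z` has positive distance from it. -/
lemma exists_mem_omegaN (z : Omega Fq) : ∃ n, z ∈ omegaN Fq n := by
  have hcl : IsClosed (Set.range (algebraMap (Kinf Fq) (Cinf Fq))) :=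
    (algebraMap_isometry (Kinf Fq) (Cinf Fq)).isClosedEmbedding.isClosed_range
  obtain ⟨ε, hε, hball⟩ := Metric.isOpen_iff.1 hcl.isOpen_compl z.1 z.2
  obtain ⟨n, hn⟩ := pow_unbounded_of_one_lt (max ‖(z : Cinf Fq)‖ ε⁻¹) (one_lt_natCard Fq)
  refine ⟨n, ((le_max_left _ _).trans_lt hn).le, fun x => ?_⟩
  have h1 : ((Nat.card Fq : ℝ) ^ n)⁻¹ ≤ ε :=
    inv_le_of_inv_le₀ hε ((le_max_right _ _).trans_lt hn).le
  by_contra hlt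
  push Not at hlt
  refine hball ?_ ⟨x, rfl⟩
  rw [Metric.mem_ball, dist_comm, dist_eq_norm]
  exact hlt.trans_le h1

end Norms

/-! ### Grouping the terms of the Eisenstein series by constants -/

section Grouping

variable {Fq : Type*} [Field Fq] [Fintype Fq]

variable (Fq) in
lemma card_cast_eq_zero : ((Fintype.card Fq : ℕ) : Cinf Fq) = 0 := by
  have h : ((Fintype.card Fq : ℕ) : Fq) = 0 := FiniteField.cast_card_eq_zero Fq
  have := congr_arg ((polyToCinf Fq).comp C) h
  rwa [map_natCast, map_zero] at this

/-- This is the logarithmic derivative of `∏ (X + c) = X^q - X`, whose derivative is `-1` in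
characteristic `p`. -/
lemma sum_inv_add_const_mul_prod (u : Cinf Fq) (hu : ∀ c : Fq, u + polyToCinf Fq (C c) ≠ 0) :
    (∑ c : Fq, (u + polyToCinf Fq (C c))⁻¹) * ∏ c : Fq, (u + polyToCinf Fq (C c)) = -1 := by
  classical
  have h1 : ∏ c : Fq, (X + C c) = X ^ Fintype.card Fq - X := by
    have h2 := prod_multiset_X_sub_C_of_monic_of_roots_card_eq
      (p := (X ^ Fintype.card Fq - X : Fq[X]))
      (monic_X_pow_sub (by rw [degree_X]; exact_mod_cast Fintype.one_lt_card))
      (by rw [FiniteField.roots_X_pow_card_sub_X,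
        FiniteField.X_pow_card_sub_X_natDegree_eq _ Fintype.one_lt_card]; rfl)
    rw [FiniteField.roots_X_pow_card_sub_X] at h2
    rw [← h2]
    change _ = ∏ c : Fq, (X - C c)
    refine Fintype.prod_equiv (Equiv.neg Fq) _ _ fun c => ?_
    simp
  have h3 := congr_arg (fun p => (derivative p).eval₂ ((polyToCinf Fq).comp C) u) h1
  simp only [derivative_prod_finset, derivative_sub, derivative_X_pow, derivative_X,
    FiniteField.cast_card_eq_zero, derivative_add, derivative_C, eval₂_finsetSum,
    eval₂_finsetProd, eval₂_add, eval₂_X, eval₂_C, eval₂_one, eval₂_neg, add_zero,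
    mul_one, map_zero, zero_mul, zero_sub, RingHom.comp_apply] at h3
  rw [← h3, Finset.sum_mul]
  refine Finset.sum_congr rfl fun c _ => ?_
  rw [← Finset.mul_prod_erase _ _ (Finset.mem_univ c), inv_mul_cancel_left₀ (hu c)]

/-- The sum of the `a / (az + b)` over the `b` that agree with `Xβ` up to a constant. -/
def groupedTerm (p : Fq[X] × Fq[X]) (z : Omega Fq) : Cinf Fq :=
  ∑ c : Fq, polyToCinf Fq p.1 / lin p.1 (X * p.2 + C c) z

/-- By the previous identity the grouped term is `-a` divided by a product of `q` linear factors,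
each of size at least `δM`. Since `δM ≥ 1` and `q ≥ 2`, the product is at least `(δM)²`, which gains
one factor `M` over `|a| ≤ M`. -/
lemma norm_groupedTerm_le {n : ℕ} {z : Omega Fq} (hz : z ∈ omegaN Fq n) (p : Fq[X] × Fq[X])
    (hp : 1 ≤ linBound Fq n * max ‖polyToCinf Fq p.1‖ ‖polyToCinf Fq p.2‖) :
    ‖groupedTerm p z‖ ≤
      (linBound Fq n ^ 2)⁻¹ * (max ‖polyToCinf Fq p.1‖ ‖polyToCinf Fq p.2‖)⁻¹ := by
  obtain ⟨a, b⟩ := p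
  simp only at hp ⊢
  set δ := linBound Fq n
  set M := max ‖polyToCinf Fq a‖ ‖polyToCinf Fq b‖
  have hδ : 0 < δ := linBound_pos Fq n
  have hM : 0 < M := pos_of_mul_pos_right (one_pos.trans_le hp) hδ.le
  by_cases ha : a = 0
  · simp only [groupedTerm, ha, map_zero, zero_div, Finset.sum_const_zero, norm_zero]
    positivity
  set u := polyToCinf Fq a * z + polyToCinf Fq (X * b) with hu
  have hlin (c : Fq) : lin a (X * b + C c) z = u + polyToCinf Fq (C c) := by
    rw [lin, map_add, hu, add_assoc]
  have hne (c : Fq) : u + polyToCinf Fq (C c) ≠ 0 := by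
    rw [← hlin]
    exact fun h => ha (lin_eq_zero h).1
  have hge (c : Fq) : δ * M ≤ ‖u + polyToCinf Fq (C c)‖ := by
    rw [← hlin]
    refine le_trans ?_ (linBound_mul_le_norm_lin hz _ _)
    gcongr
    exact max_le_max le_rfl (norm_le_norm_X_mul_add_C b c)
  have hprod : (δ * M) ^ 2 ≤ ∏ c : Fq, ‖u + polyToCinf Fq (C c)‖ := by
    calc (δ * M) ^ 2 ≤ (δ * M) ^ Fintype.card Fq :=
          pow_le_pow_right₀ hp Fintype.one_lt_card
      _ = ∏ c : Fq, (δ * M) := by rw [Finset.prod_const, Finset.card_univ]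
      _ ≤ _ := Finset.prod_le_prod (fun _ _ => by positivity) fun c _ => hge c
  have hsum := congr_arg norm (sum_inv_add_const_mul_prod u hne)
  rw [norm_mul, norm_neg, norm_one, norm_prod] at hsum
  have hpos : 0 < ∏ c : Fq, ‖u + polyToCinf Fq (C c)‖ := lt_of_lt_of_le (by positivity) hprod
  have hF : groupedTerm (a, b) z = polyToCinf Fq a * ∑ c : Fq, (u + polyToCinf Fq (C c))⁻¹ := by
    rw [groupedTerm, Finset.mul_sum]
    exact Finset.sum_congr rfl fun c _ => by rw [hlin, div_eq_mul_inv]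
  rw [hF, norm_mul, eq_div_of_mul_eq hpos.ne' hsum]
  calc ‖polyToCinf Fq a‖ * (1 / ∏ c : Fq, ‖u + polyToCinf Fq (C c)‖)
      ≤ M * (1 / (δ * M) ^ 2) := by
        gcongr
        exact le_max_left _ _
    _ = _ := by field_simp

/-- On each `Ω_n`, all but finitely many of the grouped terms are uniformly small. -/
lemma exists_finset_norm_groupedTerm_le (n : ℕ) {ε : ℝ} (hε : 0 < ε) :
    ∃ S : Finset (Fq[X] × Fq[X]), ∀ z ∈ omegaN Fq n, ∀ p ∉ S, ‖groupedTerm p z‖ ≤ ε := by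
  set δ := linBound Fq n
  have hδ : 0 < δ := linBound_pos Fq n
  -- The first entry secures the hypothesis `1 ≤ δM` of `norm_groupedTerm_le`; the second makes the
  -- resulting bound at most `ε`.
  set B := max δ⁻¹ ((δ ^ 2)⁻¹ * ε⁻¹)
  have hfin := (finite_norm_polyToCinf_le (Fq := Fq) B).prod
    (finite_norm_polyToCinf_le (Fq := Fq) B)
  refine ⟨hfin.toFinset, fun z hz p hp => ?_⟩
  have hM : B ≤ max ‖polyToCinf Fq p.1‖ ‖polyToCinf Fq p.2‖ := by
    by_contra hlt
    push Not at hlt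
    refine hp (hfin.mem_toFinset.2 ⟨?_, ?_⟩)
    exacts [(le_max_left _ _).trans hlt.le, (le_max_right _ _).trans hlt.le]
  set M := max ‖polyToCinf Fq p.1‖ ‖polyToCinf Fq p.2‖
  have h1 : δ⁻¹ ≤ M := (le_max_left _ _).trans hM
  have h2 : (δ ^ 2)⁻¹ * ε⁻¹ ≤ M := (le_max_right _ _).trans hM
  have hM0 : 0 < M := (inv_pos.2 hδ).trans_le h1
  refine (norm_groupedTerm_le hz p ?_).trans ?_
  · calc (1 : ℝ) = δ * δ⁻¹ := by field_simp
      _ ≤ δ * M := by gcongr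
  · rw [mul_inv_le_iff₀ hM0]
    calc (δ ^ 2)⁻¹ = ε * ((δ ^ 2)⁻¹ * ε⁻¹) := by field_simp
      _ ≤ ε * M := by gcongr

lemma summable_groupedTerm (z : Omega Fq) : Summable fun p => groupedTerm p z := by
  obtain ⟨n, hn⟩ := exists_mem_omegaN z
  refine NonarchimedeanAddGroup.summable_of_tendsto_cofinite_zero ?_
  rw [Metric.tendsto_nhds]
  intro ε hε
  obtain ⟨S, hS⟩ := exists_finset_norm_groupedTerm_le (Fq := Fq) n (half_pos hε)
  refine S.finite_toSet.subset fun p hp => ?_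
  by_contra h
  refine hp ?_
  change dist _ _ < ε
  rw [dist_zero_right]
  linarith [hS z hn p h]

/-- The sum of the grouped terms. -/
def groupedSum (z : Omega Fq) : Cinf Fq := ∑' p, groupedTerm p z

/-- A finite partial sum is rational with poles in `K`, hence off `Ω`. The ultrametric inequality
bounds the tail by its largest terms, uniformly on `Ω_n`. -/
lemma isRigid_groupedSum : IsRigid (groupedSum (Fq := Fq)) := by
  classical
  intro n ε hε
  obtain ⟨S, hS⟩ := exists_finset_norm_groupedTerm_le (Fq := Fq) n hε
  refine ⟨∑ p ∈ S, groupedTerm p, sum_mem fun p _ => ?_, fun z hz => ?_⟩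
  · by_cases ha : p.1 = 0
    · have : groupedTerm p = 0 := by
        funext z
        simp [groupedTerm, ha]
      rw [this]
      exact zero_mem _
    have ha' : polyToCinf Fq p.1 ≠ 0 := by
      rw [← norm_pos_iff]
      linarith [one_le_norm_polyToCinf ha]
    have : groupedTerm p = ∑ c : Fq, fun z : Omega Fq =>
        ((z : Cinf Fq) - -polyToCinf Fq (X * p.2 + C c) / polyToCinf Fq p.1)⁻¹ := by
      funext z
      rw [groupedTerm, Finset.sum_apply]
      refine Finset.sum_congr rfl fun c _ => ?_
      have h1 : lin p.1 (X * p.2 + C c) z ≠ 0 := fun h => ha (lin_eq_zero h).1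
      rw [div_eq_iff h1, ← div_eq_inv_mul, eq_div_iff, lin]
      · field_simp
        ring
      · intro h
        apply h1
        rw [lin]
        field_simp at h
        linear_combination h
    rw [this]
    refine sum_mem fun c _ => Algebra.subset_adjoin (Or.inr ⟨_, fun z _ hz => ?_, rfl⟩)
    refine z.2 ⟨-toKinf Fq (algebraMap _ _ (X * p.2 + C c)) / toKinf Fq (algebraMap _ _ p.1), ?_⟩
    rw [hz, map_div₀, map_neg]
    rfl
  · have h1 := (summable_groupedTerm z).sum_add_tsum_subtype_compl S
    rw [groupedSum, ← h1, Finset.sum_apply, add_sub_cancel_left]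
    exact IsUltrametricDist.norm_tsum_le_of_forall_le_of_nonneg hε.le fun p => hS z hz p p.2

end Grouping

/-! ### The false Eisenstein series as a sum of grouped terms -/

section Regroup

open Filter Topology

variable {Fq : Type*} [Field Fq] [Fintype Fq]

variable (Fq) in
/-- Splitting off the constant coefficient of a polynomial. -/
def splitConst : Fq[X] × Fq ≃ Fq[X] where
  toFun p := X * p.1 + C p.2
  invFun b := (divX b, b.coeff 0)
  left_inv p := by
    ext
    · simp [coeff_divX]
    · simp
  right_inv b := by
    change X * divX b + C (b.coeff 0) = b
    rw [mul_comm, divX_mul_X_add]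

variable (Fq) in
/-- A nonzero polynomial is a unit times a monic polynomial. -/
def monicProdUnits : {a : Fq[X] // a.Monic} × Fqˣ ≃ {a : Fq[X] // a ≠ 0} where
  toFun p := ⟨C (p.2 : Fq) * p.1.1, mul_ne_zero (by simp) p.1.2.ne_zero⟩
  invFun a := (⟨C (a.1.leadingCoeff⁻¹) * a.1, by
      rw [Monic, leadingCoeff_mul, leadingCoeff_C, inv_mul_cancel₀ (leadingCoeff_ne_zero.2 a.2)]⟩,
    Units.mk0 a.1.leadingCoeff (leadingCoeff_ne_zero.2 a.2))
  left_inv p := by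
    ext : 1
    · ext : 1
      simp [p.1.2.leadingCoeff, ← mul_assoc, ← C_mul]
    · ext
      simp [p.1.2.leadingCoeff]
  right_inv a := by
    ext : 1
    simp [← mul_assoc, ← C_mul, a.2]

/-- For fixed `a` the terms are of size `O(1/|b|)`, so each inner sum converges unconditionally and
may be regrouped. -/
lemma summable_row (a : Fq[X]) (z : Omega Fq) :
    Summable fun b : Fq[X] => polyToCinf Fq a / lin a b z := by
  obtain ⟨n, hn⟩ := exists_mem_omegaN z
  by_cases ha : a = 0
  · simp [ha, summable_zero]
  have hδ := linBound_pos Fq n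
  refine NonarchimedeanAddGroup.summable_of_tendsto_cofinite_zero ?_
  rw [Metric.tendsto_nhds]
  intro ε hε
  refine (finite_norm_polyToCinf_le (Fq := Fq)
    (‖polyToCinf Fq a‖ / (linBound Fq n * ε))).subset fun b hb => ?_
  by_contra hlt
  refine hb ?_
  simp only [Set.mem_ofPred_eq, not_le] at hlt
  change dist _ _ < ε
  have h0 : 0 < ‖lin a b z‖ := norm_pos_iff.2 fun h => ha (lin_eq_zero h).1
  rw [dist_zero_right, norm_div, div_lt_iff₀ h0]
  rw [div_lt_iff₀ (by positivity)] at hlt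
  calc ‖polyToCinf Fq a‖ < ‖polyToCinf Fq b‖ * (linBound Fq n * ε) := hlt
    _ = ε * (linBound Fq n * ‖polyToCinf Fq b‖) := by ring
    _ ≤ ε * ‖lin a b z‖ := by
      gcongr
      refine le_trans ?_ (linBound_mul_le_norm_lin hn a b)
      gcongr
      exact le_max_right _ _

lemma tsum_row_eq (a : Fq[X]) (z : Omega Fq) :
    ∑' b : Fq[X], polyToCinf Fq a / lin a b z = ∑' b, groupedTerm (a, b) z := by
  have h := (splitConst Fq).summable_iff.2 (summable_row a z)
  rw [← (splitConst Fq).tsum_eq]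
  exact h.tsum_prod.trans (tsum_congr fun b => tsum_fintype _)

/-- Substituting `εb` for `b` lets the constant `ε` cancel from numerator and denominator. -/
lemma tsum_row_unit_mul (ε : Fqˣ) (a : Fq[X]) (z : Omega Fq) :
    ∑' b : Fq[X], polyToCinf Fq (C (ε : Fq) * a) / lin (C (ε : Fq) * a) b z =
      ∑' b : Fq[X], polyToCinf Fq a / lin a b z := by
  have hu : IsUnit (C (ε : Fq)) := isUnit_C.2 ε.isUnit
  rw [← (Units.mulLeft hu.unit).tsum_eq]
  refine tsum_congr fun b => ?_
  have h0 : polyToCinf Fq (C (ε : Fq)) ≠ 0 := by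
    rw [← map_zero (polyToCinf Fq)]
    exact polyToCinf_injective.ne hu.ne_zero
  simp only [lin, Units.mulLeft_apply, IsUnit.unit_spec, map_mul]
  rw [mul_assoc, ← mul_add, mul_div_mul_left _ _ h0]

/-- Rows depend on `a` only up to constants, so the sum over all nonzero `a` is `q - 1 = -1` times
the sum over monic `a`; this accounts for the sign. -/
lemma falseE_eq (ϖ : Cinf Fq) (z : Omega Fq) : falseE ϖ z = -ϖ⁻¹ * groupedSum z := by
  classical
  set h : Fq[X] → Cinf Fq := fun a => ∑' b : Fq[X], polyToCinf Fq a / lin a b z with hh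
  have hrow (a : Fq[X]) : h a = ∑' b, groupedTerm (a, b) z := tsum_row_eq a z
  have hsum : Summable h := by
    simp only [funext hrow]
    exact (summable_groupedTerm z).prod
  have hcard : ((Fintype.card Fqˣ : ℕ) : Cinf Fq) = -1 := by
    rw [Fintype.card_units, Nat.cast_sub Fintype.card_pos, card_cast_eq_zero]
    simp
  have hprod : Summable fun p : {a : Fq[X] // a.Monic} × Fqˣ => h (monicProdUnits Fq p) :=
    hsum.comp_injective (Subtype.val_injective.comp (monicProdUnits Fq).injective)
  have key : groupedSum z = -∑' a : {a : Fq[X] // a.Monic}, h a := by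
    calc groupedSum z = ∑' a, h a := by
          rw [groupedSum, (summable_groupedTerm z).tsum_prod]
          exact tsum_congr fun a => (hrow a).symm
      _ = ∑' a : {a : Fq[X] // a ≠ 0}, h a := by
          refine (tsum_subtype_eq_of_support_subset (s := {a | a ≠ 0}) fun a ha h0 => ha ?_).symm
          simp [hh, h0]
      _ = ∑' p, h (monicProdUnits Fq p) := ((monicProdUnits Fq).tsum_eq _).symm
      _ = ∑' (a : {a : Fq[X] // a.Monic}) (_ : Fqˣ), h a :=
          hprod.tsum_prod.trans (tsum_congr fun a => tsum_congr fun ε => tsum_row_unit_mul ε a z)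
      _ = ∑' a : {a : Fq[X] // a.Monic}, -h a := tsum_congr fun a => by
          rw [tsum_fintype, Finset.sum_const, Finset.card_univ, nsmul_eq_mul, hcard, neg_one_mul]
      _ = _ := tsum_neg
  rw [key, neg_mul_neg]
  rfl

end Regroup

/-! ### The transformation law -/

section Transformation

open Filter Topology

variable {Fq : Type*} [Field Fq] [Fintype Fq]

/-- The grouped sum is the limit of the sums over any exhausting sequence of finite sets that are
eventually stable under translation by constants in the second component. -/
lemma tendsto_sum_lattice (z : Omega Fq) (L : ℕ → Finset (Fq[X] × Fq[X]))
    (h1 : ∀ v, ∀ᶠ N in atTop, v ∈ L N)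
    (h2 : ∀ᶠ N in atTop, ∀ v ∈ L N, ∀ c : Fq, (v.1, v.2 + C c) ∈ L N) :
    Tendsto (fun N => ∑ v ∈ L N, polyToCinf Fq v.1 / lin v.1 v.2 z) atTop
      (𝓝 (groupedSum z)) := by
  classical
  -- The classes modulo constants that `L N` meets, each represented by its quotient by `X`. Once `L
  -- N` is stable it is a union of full classes, and its sum equals the sum of grouped terms over `S
  -- N`.
  set S : ℕ → Finset (Fq[X] × Fq[X]) := fun N => (L N).image fun v => (v.1, divX v.2) with hS
  have hSt : Tendsto S atTop atTop := by
    refine tendsto_atTop.2 fun s => ?_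
    have : ∀ᶠ N in atTop, ∀ p ∈ s, (p.1, X * p.2) ∈ L N :=
      (eventually_all_finset s).2 fun p _ => h1 _
    filter_upwards [this] with N hN p hp
    refine Finset.mem_image.2 ⟨_, hN p hp, ?_⟩
    ext <;> simp [coeff_divX]
  refine ((summable_groupedTerm z).hasSum.comp hSt).congr' ?_
  filter_upwards [h2] with N hN
  simp only [Function.comp_apply, groupedTerm]
  rw [← Finset.sum_product']
  refine Finset.sum_nbij' (fun p => (p.1.1, X * p.1.2 + C p.2))
    (fun v => ((v.1, divX v.2), v.2.coeff 0)) ?_ ?_ ?_ ?_ ?_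
  · rintro ⟨p, c⟩ hp
    obtain ⟨v, hv, rfl⟩ := Finset.mem_image.1 (Finset.mem_product.1 hp).1
    -- This translation moves the constant coefficient of `v.2` to `c`.
    have := hN v hv (c - v.2.coeff 0)
    have e : X * divX v.2 + C c = v.2 + C (c - v.2.coeff 0) := by
      conv_rhs => rw [← divX_mul_X_add v.2]
      simp only [C_sub, coeff_add, coeff_mul_X_zero, coeff_C_zero, zero_add]
      ring
    simpa only [e] using this
  · intro v hv
    exact Finset.mem_product.2 ⟨Finset.mem_image_of_mem _ hv, Finset.mem_univ _⟩
  · rintro ⟨⟨a, b⟩, c⟩ -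
    have := (splitConst Fq).left_inv (b, c)
    simp only [splitConst, Prod.mk.injEq] at this
    simp only [this.1, this.2]
  · rintro ⟨a, b⟩ -
    have := (splitConst Fq).right_inv b
    simp only [splitConst] at this
    simp only [this]
  · rintro ⟨⟨a, b⟩, c⟩ -
    rfl

/-- The action of a matrix on row vectors. -/
def rowMul {R : Type*} [CommRing R] (g : Matrix.GeneralLinearGroup (Fin 2) R) (v : R × R) :
    R × R :=
  (v.1 * g 0 0 + v.2 * g 1 0, v.1 * g 0 1 + v.2 * g 1 1)

lemma rowMul_mul {R : Type*} [CommRing R] (g h : Matrix.GeneralLinearGroup (Fin 2) R) (v : R × R) :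
    rowMul (g * h) v = rowMul h (rowMul g v) := by
  ext <;> simp [rowMul, Matrix.mul_apply, Fin.sum_univ_two] <;> ring

lemma rowMul_one {R : Type*} [CommRing R] (v : R × R) : rowMul 1 v = v := by
  ext <;> simp [rowMul]

lemma rowMul_inv_rowMul {R : Type*} [CommRing R] (g : Matrix.GeneralLinearGroup (Fin 2) R)
    (v : R × R) : rowMul g⁻¹ (rowMul g v) = v := by
  rw [← rowMul_mul, mul_inv_cancel, rowMul_one]

lemma rowMul_rowMul_inv {R : Type*} [CommRing R] (g : Matrix.GeneralLinearGroup (Fin 2) R)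
    (v : R × R) : rowMul g (rowMul g⁻¹ v) = v := by
  rw [← rowMul_mul, inv_mul_cancel, rowMul_one]

lemma rowMul_add {R : Type*} [CommRing R] (g : Matrix.GeneralLinearGroup (Fin 2) R)
    (v w : R × R) : rowMul g (v + w) = rowMul g v + rowMul g w := by
  ext <;> simp [rowMul] <;> ring

variable (Fq) in
/-- The pairs of polynomials of degree less than `N`. -/
def box (N : ℕ) : Finset (Fq[X] × Fq[X]) :=
  (finite_degreeLT Fq N).toFinset ×ˢ (finite_degreeLT Fq N).toFinset

lemma mem_box {N : ℕ} {v : Fq[X] × Fq[X]} :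
    v ∈ box Fq N ↔ v.1.degree < N ∧ v.2.degree < N := by
  simp [box]

lemma add_mem_box {N : ℕ} {v w : Fq[X] × Fq[X]} (hv : v ∈ box Fq N) (hw : w ∈ box Fq N) :
    v + w ∈ box Fq N := by
  rw [mem_box] at *
  exact ⟨(degree_add_le _ _).trans_lt (max_lt hv.1 hw.1),
    (degree_add_le _ _).trans_lt (max_lt hv.2 hw.2)⟩

lemma eventually_mem_box (v : Fq[X] × Fq[X]) : ∀ᶠ N in atTop, v ∈ box Fq N := by
  filter_upwards [eventually_gt_atTop (max v.1.natDegree v.2.natDegree)] with N hN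
  have h (p : Fq[X]) (hp : p.natDegree < N) : p.degree < N :=
    degree_le_natDegree.trans_lt (by exact_mod_cast hp)
  exact mem_box.2 ⟨h _ ((le_max_left _ _).trans_lt hN), h _ ((le_max_right _ _).trans_lt hN)⟩

/-- The cardinality is `q^(2N)`, which vanishes in characteristic `p` as soon as `N > 0`. -/
lemma card_box_cast {N : ℕ} (hN : 0 < N) : (((box Fq N).card : ℕ) : Cinf Fq) = 0 := by
  have h : (finite_degreeLT Fq N).toFinset.card = Fintype.card Fq ^ N := by
    rw [← Nat.card_eq_card_finite_toFinset]
    have e : {p : Fq[X] | p.degree < N} ≃ degreeLT Fq N :=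
      Equiv.subtypeEquivRight fun p => mem_degreeLT.symm
    rw [Nat.card_congr (e.trans (degreeLTEquiv Fq N).toEquiv)]
    simp
  rw [box, Finset.card_product, h, Nat.cast_mul, Nat.cast_pow, card_cast_eq_zero,
    zero_pow hN.ne', zero_mul]

/-- The images of the boxes under `g` also exhaust `A²`. Boxes are closed under addition, so an
image is stable under translation by `(0, c)` once the box contains the finitely many vectors `(0,
c)g⁻¹`. -/
lemma tendsto_sum_box (g : Matrix.GeneralLinearGroup (Fin 2) Fq[X]) (z : Omega Fq) :
    Tendsto (fun N => ∑ v ∈ box Fq N, polyToCinf Fq (rowMul g v).1 /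
      lin (rowMul g v).1 (rowMul g v).2 z) atTop (𝓝 (groupedSum z)) := by
  classical
  have hinj : Function.Injective (rowMul g) :=
    Function.LeftInverse.injective (rowMul_inv_rowMul g)
  have hmem {N : ℕ} {v : Fq[X] × Fq[X]} :
      v ∈ (box Fq N).image (rowMul g) ↔ rowMul g⁻¹ v ∈ box Fq N := by
    rw [Finset.mem_image]
    constructor
    · rintro ⟨w, hw, rfl⟩
      rwa [rowMul_inv_rowMul]
    · exact fun h => ⟨_, h, rowMul_rowMul_inv g v⟩
  have := tendsto_sum_lattice z (fun N => (box Fq N).image (rowMul g))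
    (fun v => by simpa only [hmem] using eventually_mem_box _) ?_
  · refine this.congr fun N => ?_
    rw [Finset.sum_image hinj.injOn]
  · have h : ∀ᶠ N in atTop, ∀ c ∈ (Finset.univ : Finset Fq),
        rowMul g⁻¹ ((0 : Fq[X]), C c) ∈ box Fq N :=
      (eventually_all_finset _).2 fun c _ => eventually_mem_box _
    filter_upwards [h] with N hN v hv c
    rw [hmem] at hv ⊢
    have e : (v.1, v.2 + C c) = v + ((0 : Fq[X]), C c) := by ext <;> simp
    rw [e, rowMul_add]
    exact add_mem_box hv (hN c (Finset.mem_univ c))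

/-- The embedding `GL₂(A) → GL₂(K)`. -/
abbrev polyToGLK : Matrix.GeneralLinearGroup (Fin 2) Fq[X] →* GLK Fq :=
  Matrix.GeneralLinearGroup.map (n := Fin 2) (algebraMap Fq[X] (RatFunc Fq))

lemma toGL_polyToGLK_apply (g : Matrix.GeneralLinearGroup (Fin 2) Fq[X]) (i j : Fin 2) :
    algebraMap (Kinf Fq) (Cinf Fq) (toGL (polyToGLK g) i j) = polyToCinf Fq (g i j) := rfl

/-- Both grouped sums are limits over the same boxes, with row vectors `v` on the left and `vg` on
the right, so the law reduces to an identity between finite sums. -/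
lemma detC_mul_groupedSum_mob (g : Matrix.GeneralLinearGroup (Fin 2) Fq[X]) (z : Omega Fq) :
    detC (toGL (polyToGLK g)) * groupedSum (mob (toGL (polyToGLK g)) z) =
      den (toGL (polyToGLK g)) z ^ 2 * groupedSum z +
        polyToCinf Fq (g 1 0) * den (toGL (polyToGLK g)) z := by
  classical
  set γ := toGL (polyToGLK g) with hγ
  have hden : den γ z = polyToCinf Fq (g 1 0) * z + polyToCinf Fq (g 1 1) := rfl
  have hdet : detC γ = polyToCinf Fq (g 0 0) * polyToCinf Fq (g 1 1) -
      polyToCinf Fq (g 0 1) * polyToCinf Fq (g 1 0) := by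
    rw [detC_eq]
    simp only [hγ, toGL_polyToGLK_apply]
  have hmob : (mob γ z : Cinf Fq) * den γ z =
      polyToCinf Fq (g 0 0) * z + polyToCinf Fq (g 0 1) :=
    div_mul_cancel₀ _ (den_ne_zero γ z)
  have hj := den_ne_zero γ z
  have hl : Tendsto (fun N => ∑ v ∈ box Fq N, polyToCinf Fq v.1 / lin v.1 v.2 (mob γ z)) atTop
      (𝓝 (groupedSum (mob γ z))) := by
    simpa only [rowMul_one] using tendsto_sum_box 1 (mob γ z)
  have hr := tendsto_sum_box g z
  refine tendsto_nhds_unique (hl.const_mul (detC γ))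
    (((hr.const_mul (den γ z ^ 2)).add_const (polyToCinf Fq (g 1 0) * den γ z)).congr' ?_)
  filter_upwards [eventually_gt_atTop 0] with N hN
  -- For `v ≠ 0` the two terms differ by a constant independent of `v`. At `v = 0` both quotients
  -- are `0/0`, evaluated as `0`, so the constant has to be added back.
  have hterm (v : Fq[X] × Fq[X]) : detC γ * (polyToCinf Fq v.1 / lin v.1 v.2 (mob γ z)) =
      den γ z ^ 2 * (polyToCinf Fq (rowMul g v).1 / lin (rowMul g v).1 (rowMul g v).2 z) -
        polyToCinf Fq (g 1 0) * den γ z +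
        if v = 0 then polyToCinf Fq (g 1 0) * den γ z else 0 := by
    split_ifs with h0
    · simp [h0, rowMul]
    · have hu : lin v.1 v.2 (mob γ z) ≠ 0 := fun h => h0 (Prod.ext_iff.2 (lin_eq_zero h))
      have hU : lin (rowMul g v).1 (rowMul g v).2 z = den γ z * lin v.1 v.2 (mob γ z) := by
        simp only [lin, rowMul, map_add, map_mul]
        rw [hden] at hmob ⊢
        linear_combination -polyToCinf Fq v.1 * hmob
      rw [hU]
      field_simp
      simp only [rowMul, map_add, map_mul]
      rw [hdet]
      rw [hden] at hmob ⊢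
      linear_combination polyToCinf Fq (g 1 0) * polyToCinf Fq v.1 * hmob
  have h0 : (0 : Fq[X] × Fq[X]) ∈ box Fq N := mem_box.2 (by simp [bot_lt_iff_ne_bot])
  -- The constant summed over the box vanishes with the cardinality of the box; the correction at `v
  -- = 0` survives.
  rw [Finset.mul_sum, Finset.mul_sum, Finset.sum_congr rfl fun v _ => hterm v,
    Finset.sum_add_distrib, Finset.sum_sub_distrib, Finset.sum_const, nsmul_eq_mul,
    card_box_cast hN, Finset.sum_ite_eq' _ _ _, if_pos h0]
  ring

end Transformation

/-! ### The false Eisenstein series is quasi-modular -/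

section QuasiModular

variable {Fq : Type*} [Field Fq] [Finite Fq] (ϖ : Cinf Fq)

/-- The upper triangular unipotent matrix with entry `b`. -/
def upperUnipotent {R : Type*} [CommRing R] (b : R) : Matrix.GeneralLinearGroup (Fin 2) R :=
  ⟨!![1, b; 0, 1], !![1, -b; 0, 1], by ext i j; fin_cases i <;> fin_cases j <;> simp,
    by ext i j; fin_cases i <;> fin_cases j <;> simp⟩

lemma slash_falseE {γ : GLK Fq} (hγ : γ ∈ GLA Fq) (z : Omega Fq) :
    slash 2 1 (toGL γ) (falseE ϖ) z = falseE ϖ z - ϖ⁻¹ * kappa (toGL γ) z := by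
  have := Fintype.ofFinite Fq
  obtain ⟨g, hg⟩ := hγ
  change polyToGLK g = γ at hg
  subst hg
  have h := detC_mul_groupedSum_mob g z
  have hj := den_ne_zero (toGL (polyToGLK g)) z
  have e : den (toGL (polyToGLK g)) z ^ (-2 : ℤ) = (den (toGL (polyToGLK g)) z ^ 2)⁻¹ := by
    rw [zpow_neg]
    norm_cast
  rw [slash, zpow_one, e, falseE_eq, falseE_eq, kappa, toGL_polyToGLK_apply]
  field_simp
  linear_combination (-ϖ⁻¹) * h

/-- Translation by `a ∈ A` is the action of a unipotent matrix with `c = 0`, for which the defect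
vanishes; the period ideal is all of `A`. -/
lemma isPeriodic_falseE : IsPeriodic (falseE ϖ) := by
  refine ⟨⊤, top_ne_bot, fun a _ z w hzw => ?_⟩
  have hmem : polyToGLK (upperUnipotent a) ∈ GLA Fq := ⟨_, rfl⟩
  have h := slash_falseE ϖ hmem z
  have h10 : toGL (polyToGLK (upperUnipotent a)) 1 0 = 0 := by simp [toGL, upperUnipotent]
  have hden : den (toGL (polyToGLK (upperUnipotent a))) z = 1 := by
    simp [den, toGL, upperUnipotent]
  have hdet : detC (toGL (polyToGLK (upperUnipotent a))) = 1 := by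
    rw [detC_eq]
    simp [toGL, upperUnipotent]
  have hmob : mob (toGL (polyToGLK (upperUnipotent a))) z = w := by
    apply Subtype.ext
    change num _ z / den _ z = _
    rw [hden, hzw]
    simp [num, toGL, upperUnipotent, polyToCinf]
  rw [slash, kappa, h10, hden, hdet, hmob] at h
  simpa using h

lemma falseE_mem_ringO : falseE ϖ ∈ ringO Fq := by
  have := Fintype.ofFinite Fq
  refine ⟨?_, isPeriodic_falseE ϖ⟩
  have h : falseE ϖ = constFun Fq (-ϖ⁻¹) * groupedSum := funext fun z => falseE_eq ϖ z
  rw [h]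
  exact (IsRigid.algebraMap _).mul isRigid_groupedSum

lemma isAssocPoly_falseE {Γ : Subgroup (GLK Fq)} (hΓ : Γ ≤ GLA Fq) :
    IsAssocPoly Γ 2 1 (falseE ϖ) (polyE ϖ) := by
  refine ⟨coeff_polyE_mem (falseE_mem_ringO ϖ), fun γ hγ z => ?_⟩
  rw [slash_falseE ϖ (hΓ hγ) z, sum_eq_eval]
  simp [polyE, evalAt]

end QuasiModular

/-! ### Maps of graded algebras -/

section GradedMap

variable {ι k R S : Type*} [DecidableEq ι] [AddMonoid ι] [CommSemiring k] [Semiring R]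
  [Semiring S] [Algebra k R] [Algebra k S] (𝒜 : ι → Submodule k R) (ℬ : ι → Submodule k S)
  [SetLike.GradedMonoid 𝒜] [SetLike.GradedMonoid ℬ]

/-- The map of external direct sums induced by an algebra homomorphism that respects two families
of submodules. -/
def gradedMap (F : R →ₐ[k] S) (h : ∀ i, ∀ x ∈ 𝒜 i, F x ∈ ℬ i) : (⨁ i, 𝒜 i) →ₐ[k] ⨁ i, ℬ i :=
  DirectSum.toAlgebra k (fun i => 𝒜 i)
    (fun i => (DirectSum.lof k ι (fun i => ℬ i) i).comp (F.toLinearMap.restrict (h i)))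
    (by
      rw [DirectSum.one_def]
      refine congr_arg (DirectSum.of (fun i => ℬ i) 0) (Subtype.ext ?_)
      exact map_one F)
    (fun {i j} ai aj => by
      refine Eq.trans ?_ (DirectSum.of_mul_of (A := fun i => ℬ i) _ _).symm
      refine congr_arg (DirectSum.of (fun i => ℬ i) (i + j)) (Subtype.ext ?_)
      exact map_mul F _ _)

variable {𝒜 ℬ} (F : R →ₐ[k] S) (h : ∀ i, ∀ x ∈ 𝒜 i, F x ∈ ℬ i)

lemma gradedMap_of (i : ι) (x : 𝒜 i) : gradedMap 𝒜 ℬ F h (DirectSum.of (fun i => 𝒜 i) i x) =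
    DirectSum.of (fun i => ℬ i) i ⟨F x, h i x x.2⟩ :=
  DirectSum.toAddMonoid_of (β := fun i => 𝒜 i) (fun i => ((DirectSum.lof k ι (fun i => ℬ i) i).comp
    (F.toLinearMap.restrict (h i))).toAddMonoidHom) i x

lemma coe_gradedMap_apply (x : ⨁ i, 𝒜 i) (i : ι) :
    (gradedMap 𝒜 ℬ F h x i : S) = F (x i : R) := by
  induction x using DirectSum.induction_on with
  | zero => simp
  | of j y =>
    rw [gradedMap_of, DirectSum.coe_of_apply, DirectSum.coe_of_apply]
    split_ifs <;> simp
  | add x y hx hy => simp [map_add, hx, hy]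

lemma gradedMap_smul (c : k) (x : ⨁ i, 𝒜 i) :
    gradedMap 𝒜 ℬ F h (c • x) = c • gradedMap 𝒜 ℬ F h x :=
  map_smul (gradedMap 𝒜 ℬ F h) c x

lemma gradedMap_bijective (hinj : ∀ i, ∀ x ∈ 𝒜 i, ∀ y ∈ 𝒜 i, F x = F y → x = y)
    (hsurj : ∀ i, ∀ y ∈ ℬ i, ∃ x ∈ 𝒜 i, F x = y) :
    Function.Bijective (gradedMap 𝒜 ℬ F h) := by
  constructor
  · intro x y hxy
    ext i
    refine hinj i _ (x i).2 _ (y i).2 ?_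
    rw [← coe_gradedMap_apply F h, ← coe_gradedMap_apply F h, hxy]
  · intro y
    induction y using DirectSum.induction_on with
    | zero => exact ⟨0, map_zero _⟩
    | of i y =>
      obtain ⟨x, hx, hxy⟩ := hsurj i y y.2
      exact ⟨DirectSum.of (fun i => 𝒜 i) i ⟨x, hx⟩, by rw [gradedMap_of]; congr⟩
    | add y z hy hz =>
      obtain ⟨x, rfl⟩ := hy
      obtain ⟨x', rfl⟩ := hz
      exact ⟨x + x', map_add _ _ _⟩

/-- A common form for the multiplicativity of the three depth filtrations: a component of a product
is a finite sum of products of components. -/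
lemma coe_mul_apply_mem {x y : ⨁ i, 𝒜 i} {U V W : ι → Submodule k R}
    (hUV : ∀ i j, ∀ a ∈ U i, ∀ b ∈ V j, a * b ∈ W (i + j)) (hx : ∀ i, (x i : R) ∈ U i)
    (hy : ∀ i, (y i : R) ∈ V i) (i : ι) : ((x * y) i : R) ∈ W i := by
  classical
  rw [DirectSum.coe_mul_apply]
  refine sum_mem fun p hp => ?_
  rw [← (Finset.mem_filter.1 hp).2]
  exact hUV _ _ _ (hx _) _ (hy _)

end GradedMap

/-! ### Filtered algebras -/

section Filtered

variable {Fq : Type*} [Field Fq] [Finite Fq] (Γ : Subgroup (GLK Fq))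

lemma filQM_mul_le (a b : ℕ) : filQM Γ a * filQM Γ b ≤ filQM Γ (a + b) :=
  (@Submodule.mul_le _ _ _ _ _ (_) _ _ _).2 fun _ hx _ hy =>
    coe_mul_apply_mem (𝒜 := grQM Γ) (U := fun i => QML Γ i.1 i.2 a)
      (V := fun i => QML Γ i.1 i.2 b) (W := fun i => QML Γ i.1 i.2 (a + b))
      (fun _ _ _ hf _ hg => QML_mul hf hg) hx hy

lemma filEX_mul_le (a b : ℕ) : filEX Γ a * filEX Γ b ≤ filEX Γ (a + b) :=
  (@Submodule.mul_le _ _ _ _ _ (_) _ _ _).2 fun _ hx _ hy =>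
    coe_mul_apply_mem (𝒜 := grEX Γ) (U := fun i => EXL Γ i.1 i.2 a)
      (V := fun i => EXL Γ i.1 i.2 b) (W := fun i => EXL Γ i.1 i.2 (a + b))
      (fun _ _ _ hf _ hg => ⟨EX_mul hf.1 hg.1, natDegree_mul_le_of_le hf.2 hg.2⟩) hx hy

lemma filWP_mul_le (a b : ℕ) : filWP Γ a * filWP Γ b ≤ filWP Γ (a + b) :=
  (@Submodule.mul_le _ _ _ _ _ (_) _ _ _).2 fun _ hx _ hy =>
    coe_mul_apply_mem (𝒜 := grWP Γ) (U := fun i => WPL Γ i.1 i.2 a)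
      (V := fun i => WPL Γ i.1 i.2 b) (W := fun i => WPL Γ i.1 i.2 (a + b))
      (fun _ _ _ hf _ hg => WPL_mul hf hg) hx hy

end Filtered

/-! ### Isomorphisms in each weight and type -/

section Isomorphisms

variable {Fq : Type*} [Field Fq] [Finite Fq] {ϖ : Cinf Fq} {Γ : Subgroup (GLK Fq)} {k m : ℤ}
  {P Q : (Omega Fq → Cinf Fq)[X]}

/-- Substitution of the function `E`. -/
def substE (ϖ : Cinf Fq) : (Omega Fq → Cinf Fq)[X] →ₐ[Cinf Fq] (Omega Fq → Cinf Fq) :=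
  (aeval (falseE ϖ)).restrictScalars (Cinf Fq)

/-- Composition with a polynomial, as a homomorphism of `ℂ_∞`-algebras. -/
def compHom (R : (Omega Fq → Cinf Fq)[X]) :
    (Omega Fq → Cinf Fq)[X] →ₐ[Cinf Fq] (Omega Fq → Cinf Fq)[X] :=
  (aeval R).restrictScalars (Cinf Fq)

lemma substE_apply (Q : (Omega Fq → Cinf Fq)[X]) : substE ϖ Q = Q.eval (falseE ϖ) :=
  congr_fun (coe_aeval_eq_eval (falseE ϖ)) Q

lemma comp_polyE_comp_polyEInv (hϖ : ϖ ≠ 0) (Q : (Omega Fq → Cinf Fq)[X]) :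
    (Q.comp (polyE ϖ)).comp (polyEInv ϖ) = Q := by
  rw [comp_assoc, polyE_comp_polyEInv hϖ, comp_X]

lemma comp_polyEInv_comp_polyE (hϖ : ϖ ≠ 0) (Q : (Omega Fq → Cinf Fq)[X]) :
    (Q.comp (polyEInv ϖ)).comp (polyE ϖ) = Q := by
  rw [comp_assoc, polyEInv_comp_polyE hϖ, comp_X]

lemma comp_polyE_mem_WP (hΓ : IsArithmeticCongruence Γ) (hΓA : Γ ≤ GLA Fq) (hQ : Q ∈ EX Γ k m) :
    Q.comp (polyE ϖ) ∈ WP Γ k m :=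
  ((isAssocPoly_iff_mem_WP hΓ).1 (isAssocPoly_comp_polyE (isAssocPoly_falseE ϖ hΓA) hQ)).1

/-- Depth and degree in `E` agree because `Q` and the unique associated polynomial `Q ∘ P_E` are
obtained from each other by compositions that do not raise degrees. -/
lemma eval_falseE_mem_QML_iff (hϖ : ϖ ≠ 0) (hΓ : IsArithmeticCongruence Γ) (hΓA : Γ ≤ GLA Fq)
    (hQ : Q ∈ EX Γ k m) (ℓ : ℕ) : Q.eval (falseE ϖ) ∈ QML Γ k m ℓ ↔ Q ∈ EXL Γ k m ℓ := by
  have hA := isAssocPoly_comp_polyE (isAssocPoly_falseE ϖ hΓA) hQ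
  constructor
  · rintro ⟨-, P, hP, hℓ⟩
    refine ⟨hQ, ?_⟩
    rw [← comp_polyE_comp_polyEInv hϖ Q, hA.unique hΓ hP]
    exact (natDegree_comp_polyEInv_le P).trans hℓ
  · intro h
    exact (mem_QML_iff hΓ).2
      ⟨_, hA.mem_WPL hΓ ((natDegree_comp_polyE_le Q).trans h.2), hA.coeff_zero⟩

lemma eval_falseE_mem_QM (hϖ : ϖ ≠ 0) (hΓ : IsArithmeticCongruence Γ) (hΓA : Γ ≤ GLA Fq)
    (hQ : Q ∈ EX Γ k m) : Q.eval (falseE ϖ) ∈ QM Γ k m :=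
  mem_QM.2 ⟨_, (eval_falseE_mem_QML_iff hϖ hΓ hΓA hQ _).2 ⟨hQ, le_rfl⟩⟩

/-- The function `Q(E)` determines its associated polynomial `Q ∘ P_E`, and composition with `P_E`
is invertible. -/
lemma eq_of_eval_falseE_eq (hϖ : ϖ ≠ 0) (hΓ : IsArithmeticCongruence Γ) (hΓA : Γ ≤ GLA Fq)
    (hP : P ∈ EX Γ k m) (hQ : Q ∈ EX Γ k m) (h : P.eval (falseE ϖ) = Q.eval (falseE ϖ)) :
    P = Q := by
  have hE := isAssocPoly_falseE ϖ hΓA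
  have h1 := isAssocPoly_comp_polyE hE hP
  rw [h] at h1
  rw [← comp_polyE_comp_polyEInv hϖ P, h1.unique hΓ (isAssocPoly_comp_polyE hE hQ),
    comp_polyE_comp_polyEInv hϖ]

lemma eval_falseE_comp_polyEInv (hϖ : ϖ ≠ 0) (P : (Omega Fq → Cinf Fq)[X]) :
    (P.comp (polyEInv ϖ)).eval (falseE ϖ) = P.coeff 0 := by
  rw [← coeff_zero_comp_polyE, comp_polyEInv_comp_polyE hϖ]

/-- The expansion is `P_f` composed with the inverse of `P_E`; its value at `E` is the constant
coefficient of `P_f`, which is `f`. -/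
lemma exists_eval_falseE_eq (hϖ : ϖ ≠ 0) (hΓ : IsArithmeticCongruence Γ) (hΓA : Γ ≤ GLA Fq)
    {f : Omega Fq → Cinf Fq} (hf : f ∈ QM Γ k m) : ∃ Q ∈ EX Γ k m, Q.eval (falseE ϖ) = f := by
  obtain ⟨ℓ, hℓ⟩ := mem_QM.1 hf
  obtain ⟨P, hP, rfl⟩ := (mem_QML_iff hΓ).1 hℓ
  exact ⟨_, comp_polyEInv_mem_EX hϖ (isAssocPoly_falseE ϖ hΓA) (mem_WP.2 ⟨ℓ, hP⟩),
    eval_falseE_comp_polyEInv hϖ P⟩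

/-- A homomorphism of `ℂ_∞`-algebras that maps `e` to `e'` is linear over `ℂ_∞[E]`. -/
@[reducible] def algEHom {R S : Type*} [CommSemiring R] [CommSemiring S] [Algebra (Cinf Fq) R]
    [Algebra (Cinf Fq) S] (e : R) (e' : S) (f : R →ₐ[Cinf Fq] S) (h : f e = e') :
    letI : Algebra (Cinf Fq)[X] R := algE e
    letI : Algebra (Cinf Fq)[X] S := algE e'
    R →ₐ[(Cinf Fq)[X]] S :=
  letI : Algebra (Cinf Fq)[X] R := algE e
  letI : Algebra (Cinf Fq)[X] S := algE e'
  { f.toRingHom with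
    commutes' := fun p => by
      change f (aeval e p) = aeval e' p
      rw [← h, aeval_algHom_apply] }

end Isomorphisms

end DrinfeldQM

end

theorem theorem3p7 {Fq : Type*} [Field Fq] [Finite Fq]
    (ϖ : Cinf Fq) (hϖ : IsCarlitzPeriod ϖ)
    (Γ : Subgroup (GLK Fq)) (hΓ : IsArithmeticCongruence Γ) (hΓA : Γ ≤ GLA Fq) :
    ∃ (hE : falseE ϖ ∈ grQM Γ (2, 1)) (hPE : polyE ϖ ∈ grWP Γ (2, 1))
      (ev : ∀ k m : ℤ, EX Γ k m ≃ₗ[Cinf Fq] QM Γ k m)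
      (ψ : ∀ k m : ℤ, EX Γ k m →ₗ[Cinf Fq] WP Γ k m)
      (φ : ∀ k m : ℤ, WP Γ k m →ₗ[Cinf Fq] EX Γ k m),
      -- in each weight and type:
      (∀ k m : ℤ,
        -- `ev` identifies `⨁ W_{k-2i,m-i} Eⁱ` with `W̃_{k,m}` by substituting the function `E`,
        -- compatibly with the depth
        (∀ Q : EX Γ k m, (ev k m Q : Omega Fq → Cinf Fq) =
          (Q : (Omega Fq → Cinf Fq)[X]).eval (falseE ϖ)) ∧
        (∀ (ℓ : ℕ) (Q : EX Γ k m), (ev k m Q : Omega Fq → Cinf Fq) ∈ QML Γ k m ℓ ↔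
          (Q : (Omega Fq → Cinf Fq)[X]) ∈ EXL Γ k m ℓ) ∧
        -- `ψ` sends the `E`-expansion of `f` to the (unique) associated polynomial of `f`
        (∀ (Q : EX Γ k m) (P : (Omega Fq → Cinf Fq)[X]),
          IsAssocPoly Γ k m (ev k m Q) P ↔ P = ψ k m Q) ∧
        -- `φ` sends the associated polynomial of `f` to the `E`-expansion of `f`
        (∀ P : WP Γ k m, IsAssocPoly Γ k m (ev k m (φ k m P)) P) ∧
        -- they are mutually inverse and preserve the depth filtrations
        (φ k m) ∘ₗ (ψ k m) = LinearMap.id ∧ (ψ k m) ∘ₗ (φ k m) = LinearMap.id ∧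
        (∀ (ℓ : ℕ) (Q : EX Γ k m), (Q : (Omega Fq → Cinf Fq)[X]) ∈ EXL Γ k m ℓ →
          (ψ k m Q : (Omega Fq → Cinf Fq)[X]) ∈ WPL Γ k m ℓ) ∧
        (∀ (ℓ : ℕ) (P : WP Γ k m), (P : (Omega Fq → Cinf Fq)[X]) ∈ WPL Γ k m ℓ →
          (φ k m P : (Omega Fq → Cinf Fq)[X]) ∈ EXL Γ k m ℓ)) ∧
      -- `P_E = E - ϖ⁻¹ X`
      IsAssocPoly Γ 2 1 (falseE ϖ) (polyE ϖ) ∧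
      -- the three bigraded algebras are filtered algebras
      (∀ a b : ℕ, filQM Γ a * filQM Γ b ≤ filQM Γ (a + b)) ∧
      (∀ a b : ℕ, filEX Γ a * filEX Γ b ≤ filEX Γ (a + b)) ∧
      (∀ a b : ℕ, filWP Γ a * filWP Γ b ≤ filWP Γ (a + b)) ∧
      -- their `ℂ_∞[E]`-algebra structures
      letI : Algebra (Cinf Fq)[X] (AlgQM Γ) :=
        algE (DirectSum.of (fun i => grQM Γ i) (2, 1) ⟨falseE ϖ, hE⟩)
      letI : Algebra (Cinf Fq)[X] (AlgEX Γ) :=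
        algE (DirectSum.of (fun i => grEX Γ i) (2, 1) ⟨Polynomial.X, X_mem_EX Γ⟩)
      letI : Algebra (Cinf Fq)[X] (AlgWP Γ) :=
        algE (DirectSum.of (fun i => grWP Γ i) (2, 1) ⟨polyE ϖ, hPE⟩)
      -- the maps on each bidegree assemble to isomorphisms of filtered `ℂ_∞[E]`-algebras
      ∃ (Ev : AlgEX Γ ≃ₐ[(Cinf Fq)[X]] AlgQM Γ)
        (Ψ : AlgEX Γ →ₐ[(Cinf Fq)[X]] AlgWP Γ) (Φ : AlgWP Γ →ₐ[(Cinf Fq)[X]] AlgEX Γ),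
        (∀ (i : ℤ × ℤ) (Q : EX Γ i.1 i.2), Ev (DirectSum.of (fun i => grEX Γ i) i Q) =
          DirectSum.of (fun i => grQM Γ i) i (ev i.1 i.2 Q)) ∧
        (∀ (i : ℤ × ℤ) (Q : EX Γ i.1 i.2), Ψ (DirectSum.of (fun i => grEX Γ i) i Q) =
          DirectSum.of (fun i => grWP Γ i) i (ψ i.1 i.2 Q)) ∧
        (∀ (i : ℤ × ℤ) (P : WP Γ i.1 i.2), Φ (DirectSum.of (fun i => grWP Γ i) i P) =
          DirectSum.of (fun i => grEX Γ i) i (φ i.1 i.2 P)) ∧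
        (∀ x : AlgEX Γ, Φ (Ψ x) = x) ∧ (∀ y : AlgWP Γ, Ψ (Φ y) = y) ∧
        -- `ℂ_∞`-linearity
        (∀ (c : Cinf Fq) (x : AlgEX Γ), Ev (c • x) = c • Ev x ∧ Ψ (c • x) = c • Ψ x) ∧
        -- compatibility with the depth filtrations
        (∀ (ℓ : ℕ) (x : AlgEX Γ), Ev x ∈ filQM Γ ℓ ↔ x ∈ filEX Γ ℓ) ∧
        (∀ (ℓ : ℕ) (x : AlgEX Γ), x ∈ filEX Γ ℓ → Ψ x ∈ filWP Γ ℓ) ∧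
        (∀ (ℓ : ℕ) (y : AlgWP Γ), y ∈ filWP Γ ℓ → Φ y ∈ filEX Γ ℓ) := by
  have hϖ0 : ϖ ≠ 0 := hϖ.1
  have hA := isAssocPoly_falseE ϖ hΓA
  have hψ (k m : ℤ) (Q) (hQ : Q ∈ EX Γ k m) : compHom (polyE ϖ) Q ∈ WP Γ k m :=
    comp_polyE_mem_WP hΓ hΓA hQ
  have hφ (k m : ℤ) (P) (hP : P ∈ WP Γ k m) : compHom (polyEInv ϖ) P ∈ EX Γ k m :=
    comp_polyEInv_mem_EX hϖ0 hA hP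
  have hev (k m : ℤ) (Q) (hQ : Q ∈ EX Γ k m) : substE ϖ Q ∈ QM Γ k m := by
    rw [substE_apply]
    exact eval_falseE_mem_QM hϖ0 hΓ hΓA hQ
  have hinj (k m : ℤ) (P) (hP : P ∈ EX Γ k m) (Q) (hQ : Q ∈ EX Γ k m)
      (h : substE ϖ P = substE ϖ Q) : P = Q := by
    rw [substE_apply, substE_apply] at h
    exact eq_of_eval_falseE_eq hϖ0 hΓ hΓA hP hQ h
  have hsurj (k m : ℤ) (f) (hf : f ∈ QM Γ k m) : ∃ Q ∈ EX Γ k m, substE ϖ Q = f := by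
    simp only [substE_apply]
    exact exists_eval_falseE_eq hϖ0 hΓ hΓA hf
  have hψφ (Q : (Omega Fq → Cinf Fq)[X]) : compHom (polyE ϖ) (compHom (polyEInv ϖ) Q) = Q :=
    comp_polyEInv_comp_polyE hϖ0 Q
  have hφψ (Q : (Omega Fq → Cinf Fq)[X]) : compHom (polyEInv ϖ) (compHom (polyE ϖ) Q) = Q :=
    comp_polyE_comp_polyEInv hϖ0 Q
  have hevX : substE ϖ X = falseE ϖ := by rw [substE_apply, eval_X]
  have hψX : compHom (polyE ϖ) X = polyE ϖ := X_comp
  have hφE : compHom (polyEInv ϖ) (polyE ϖ) = X := polyE_comp_polyEInv hϖ0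
  have hE : falseE ϖ ∈ grQM Γ (2, 1) := hevX ▸ hev 2 1 X (X_mem_EX Γ)
  have hPE : polyE ϖ ∈ grWP Γ (2, 1) := hψX ▸ hψ 2 1 X (X_mem_EX Γ)
  have hψL (k m : ℤ) (ℓ : ℕ) (Q) (h : Q ∈ EXL Γ k m ℓ) : compHom (polyE ϖ) Q ∈ WPL Γ k m ℓ :=
    (mem_WPL_iff_of_mem_WP (hψ k m Q h.1)).2 ((natDegree_comp_polyE_le Q).trans h.2)
  have hφL (k m : ℤ) (ℓ : ℕ) (P) (h : P ∈ WPL Γ k m ℓ) : compHom (polyEInv ϖ) P ∈ EXL Γ k m ℓ :=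
    ⟨hφ k m P (mem_WP.2 ⟨ℓ, h⟩), (natDegree_comp_polyEInv_le P).trans h.2.1⟩
  have hevL (k m : ℤ) (ℓ : ℕ) (Q) (h : Q ∈ EX Γ k m) :
      substE ϖ Q ∈ QML Γ k m ℓ ↔ Q ∈ EXL Γ k m ℓ := by
    rw [substE_apply]
    exact eval_falseE_mem_QML_iff hϖ0 hΓ hΓA h ℓ
  refine ⟨hE, hPE,
    fun k m => LinearEquiv.ofBijective ((substE ϖ).toLinearMap.restrict (hev k m))
      ⟨fun P Q h => Subtype.ext (hinj k m P P.2 Q Q.2 (congr_arg Subtype.val h)),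
        fun f => (hsurj k m f f.2).elim fun Q h => ⟨⟨Q, h.1⟩, Subtype.ext h.2⟩⟩,
    fun k m => (compHom (polyE ϖ)).toLinearMap.restrict (hψ k m),
    fun k m => (compHom (polyEInv ϖ)).toLinearMap.restrict (hφ k m),
    fun k m => ⟨fun Q => substE_apply _, fun ℓ Q => hevL k m ℓ Q Q.2, fun Q P => ?_, fun P => ?_,
      LinearMap.ext fun Q => Subtype.ext (hφψ Q), LinearMap.ext fun P => Subtype.ext (hψφ P),
      fun ℓ Q h => hψL k m ℓ Q h, fun ℓ P h => hφL k m ℓ P h⟩,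
    hA, filQM_mul_le Γ, filEX_mul_le Γ, filWP_mul_le Γ, ?_⟩
  · have h := isAssocPoly_comp_polyE hA Q.2
    rw [← substE_apply] at h
    exact ⟨fun hP => hP.unique hΓ h, fun hP => hP ▸ h⟩
  -- `P` is associated to its constant coefficient, which is then recognised as the value at `E` of
  -- the expansion `φ P`.
  · have h := isAssocPoly_of_mem_WP P.2
    rw [← eval_falseE_comp_polyEInv hϖ0, ← substE_apply] at h
    exact h
  let FE : AlgEX Γ →ₐ[Cinf Fq] AlgQM Γ :=
    gradedMap (grEX Γ) (grQM Γ) (substE ϖ) fun i => hev i.1 i.2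
  let FΨ : AlgEX Γ →ₐ[Cinf Fq] AlgWP Γ :=
    gradedMap (grEX Γ) (grWP Γ) (compHom (polyE ϖ)) fun i => hψ i.1 i.2
  let FΦ : AlgWP Γ →ₐ[Cinf Fq] AlgEX Γ :=
    gradedMap (grWP Γ) (grEX Γ) (compHom (polyEInv ϖ)) fun i => hφ i.1 i.2
  -- The maps are algebra homomorphisms over `ℂ_∞`; matching the three elements through which `E`
  -- acts upgrades them to homomorphisms over `ℂ_∞[E]`.
  have hFE : FE (DirectSum.of (fun i => grEX Γ i) (2, 1) ⟨X, X_mem_EX Γ⟩) =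
      DirectSum.of (fun i => grQM Γ i) (2, 1) ⟨falseE ϖ, hE⟩ :=
    (gradedMap_of ..).trans (congr_arg _ (Subtype.ext hevX))
  have hFΨ : FΨ (DirectSum.of (fun i => grEX Γ i) (2, 1) ⟨X, X_mem_EX Γ⟩) =
      DirectSum.of (fun i => grWP Γ i) (2, 1) ⟨polyE ϖ, hPE⟩ :=
    (gradedMap_of ..).trans (congr_arg _ (Subtype.ext hψX))
  have hFΦ : FΦ (DirectSum.of (fun i => grWP Γ i) (2, 1) ⟨polyE ϖ, hPE⟩) =
      DirectSum.of (fun i => grEX Γ i) (2, 1) ⟨X, X_mem_EX Γ⟩ :=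
    (gradedMap_of ..).trans (congr_arg _ (Subtype.ext hφE))
  have hFEs (c : Cinf Fq) (x : AlgEX Γ) : FE (c • x) = c • FE x := gradedMap_smul _ _ c x
  have hFΨs (c : Cinf Fq) (x : AlgEX Γ) : FΨ (c • x) = c • FΨ x := gradedMap_smul _ _ c x
  have hbij : Function.Bijective FE :=
    gradedMap_bijective _ _ (fun i => hinj i.1 i.2) (fun i => hsurj i.1 i.2)
  let : Algebra (Cinf Fq)[X] (AlgQM Γ) :=
    algE (DirectSum.of (fun i => grQM Γ i) (2, 1) ⟨falseE ϖ, hE⟩)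
  let : Algebra (Cinf Fq)[X] (AlgEX Γ) :=
    algE (DirectSum.of (fun i => grEX Γ i) (2, 1) ⟨Polynomial.X, X_mem_EX Γ⟩)
  let : Algebra (Cinf Fq)[X] (AlgWP Γ) :=
    algE (DirectSum.of (fun i => grWP Γ i) (2, 1) ⟨polyE ϖ, hPE⟩)
  let GE : AlgEX Γ →ₐ[(Cinf Fq)[X]] AlgQM Γ :=
    algEHom (R := AlgEX Γ) (S := AlgQM Γ) _ _ FE hFE
  let GΨ : AlgEX Γ →ₐ[(Cinf Fq)[X]] AlgWP Γ :=
    algEHom (R := AlgEX Γ) (S := AlgWP Γ) _ _ FΨ hFΨ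
  let GΦ : AlgWP Γ →ₐ[(Cinf Fq)[X]] AlgEX Γ :=
    algEHom (R := AlgWP Γ) (S := AlgEX Γ) _ _ FΦ hFΦ
  have hFEc (x : AlgEX Γ) (i : ℤ × ℤ) : (FE x i : Omega Fq → Cinf Fq) = substE ϖ (x i) :=
    coe_gradedMap_apply _ _ x i
  have hFΨc (x : AlgEX Γ) (i : ℤ × ℤ) :
      (FΨ x i : (Omega Fq → Cinf Fq)[X]) = compHom (polyE ϖ) (x i) := coe_gradedMap_apply _ _ x i
  have hFΦc (y : AlgWP Γ) (i : ℤ × ℤ) :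
      (FΦ y i : (Omega Fq → Cinf Fq)[X]) = compHom (polyEInv ϖ) (y i) :=
    coe_gradedMap_apply _ _ y i
  refine ⟨AlgEquiv.ofBijective GE hbij, GΨ, GΦ, ?_⟩
  refine ⟨gradedMap_of (𝒜 := grEX Γ) (ℬ := grQM Γ) (substE ϖ) fun i => hev i.1 i.2,
    gradedMap_of (𝒜 := grEX Γ) (ℬ := grWP Γ) (compHom (polyE ϖ)) fun i => hψ i.1 i.2,
    gradedMap_of (𝒜 := grWP Γ) (ℬ := grEX Γ) (compHom (polyEInv ϖ)) fun i => hφ i.1 i.2, ?_, ?_,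
    fun c x => ⟨hFEs c x, hFΨs c x⟩, ?_, ?_, ?_⟩
  · intro x
    change FΦ (FΨ x) = x
    refine DFinsupp.ext fun i => Subtype.ext ?_
    rw [hFΦc, hFΨc, hφψ]
  · intro y
    change FΨ (FΦ y) = y
    refine DFinsupp.ext fun i => Subtype.ext ?_
    rw [hFΨc, hFΦc, hψφ]
  · intro ℓ x
    change FE x ∈ filQM Γ ℓ ↔ _
    refine forall_congr' fun i => ?_
    rw [hFEc]
    exact hevL i.1 i.2 ℓ _ (x i).2
  · intro ℓ x hx
    change FΨ x ∈ filWP Γ ℓ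
    intro i
    rw [hFΨc]
    exact hψL i.1 i.2 ℓ _ (hx i)
  · intro ℓ y hy
    change FΦ y ∈ filEX Γ ℓ
    intro i
    rw [hFΦc]
    exact hφL i.1 i.2 ℓ _ (hy i)
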